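/- A mountain is surrounded by a circular path of length 100 miles (the circuit), with the base at mile point 0 (= mile point 100). A professor starts at the base at dawn of day 1. At the base there is an unlimited supply of sealed boxes, each containing the ration for one day; initially there are no boxes elsewhere. At the dawn of each day he unseals one box that he is carrying or that is at his place (lying there, or from the supply if he is at the base); on its ration he walks at most 20 miles during that day, in any way back and forth along the path. Boxes are unsealed only at dawn, also at the base, and whatever is left of an unsealed box is lost at night. He carries rations for at most two days, so that besides the unsealed box he carries at most one sealed box at any time; he may pick up and dump sealed boxes anywhere, any finite number of times. A plan (a finite list of the moves of each day) completes the circuit if, when it is carried out, every point of the circuit is visited and the professor ends at the base. Its duration is the number of days needed: every day but the last counts for a whole day, and the last day, on which $m \le 20$ miles are walked, counts for $m/20$ day. Then the minimum duration of a plan that completes the circuit exists and equals $23\frac{25}{116}$ days. It is attained by the following plan (positions are mile points; boxes are carried one at a time): 1. Dump one ration at $8\frac{18}{29}$ and return to base ($\frac{25}{29}$ day). 2. Dump two rations at $99\frac{9}{29}$ and return to base ($\frac{4}{29}$ day). 3. Dump one at $96\frac{26}{29}$, return to $99\frac{9}{29}$, pick up two in turn, dump both at $95\frac{25}{29}$ and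 return to base (1 day). 4. Dump one at $90$ and return to base (1 day). 5. Dump one at $88\frac{28}{29}$, return to $90$, pick up one, dump it at $88\frac{28}{29}$ and return to $95\frac{25}{29}$ (1 day). 6. Dump one at $82\frac{12}{29}$ and return to $88\frac{28}{29}$ (1 day). 7. Dump one at $75\frac{20}{29}$ and return to $82\frac{12}{29}$ (1 day). 8. Return to $96\frac{26}{29}$, pick up one, dump it at $95\frac{20}{29}$ and return to base (1 day). 9. Dump one at $9\frac{9}{29}$, return to $8\frac{18}{29}$, pick up one, dump it at $9\frac{9}{29}$ and return to base (1 day). 10. Dump five at $10$ and return to base (5 days). 11. Dump one at $12\frac{19}{58}$, return to $10$, pick up one, dump it at $12\frac{19}{58}$ and return to $9\frac{9}{29}$ (1 day). 12. Dump one at $19\frac{19}{29}$ and return to $10$ (1 day). 13. Dump one at $19\frac{24}{29}$, return to $19\frac{19}{29}$, pick up one, dump it at $19\frac{24}{29}$ and return to $10$ (1 day). 14. Dump one at $21\frac{19}{116}$ and return to $12\frac{19}{58}$ (1 day). 15. Dump one at $23\frac{18}{29}$, return to $21\frac{19}{116}$, pick up one, dump it at $23\frac{18}{29}$ and return to $19\frac{24}{29}$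 (1 day). 16. Dump one at $31\frac{21}{29}$ and return to $23\frac{18}{29}$ (1 day). 17. Dump one at $35\frac{20}{29}$, return to $31\frac{21}{29}$, pick up one and get to $35\frac{20}{29}$ (1 day). 18. March to $75\frac{20}{29}$ (2 days). 19. March to base ($1\frac{25}{116}$ days). -/

import Mathlib

namespace MountainCircuit

/-- The circuit around the mountain: a circle of length one hundred miles.
The class of `0` is the base, and `(x : Circuit)` is the `x`-mile point. -/
abbrev Circuit : Type := AddCircle (100 : ℝ)

/-- The actions of the professor during a day: walk `|d|` miles (in the direction of
increasing mile points if `d > 0`, in the opposite direction if `d < 0`), pick up a sealed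
box, or dump the sealed box that he is carrying. -/
inductive Move where
  | walk (d : ℝ)
  | pickUp
  | dump

/-- `place` is where the professor is, `carrying` tells whether he carries a sealed box,
`dumps` is the multiset of the positions of the sealed boxes lying along the circuit (apart from
the unlimited supply at the base), and `seen` is the set of points where he has been. -/
structure State where
  place : Circuit
  carrying : Bool
  dumps : Multiset Circuit
  seen : Set Circuit

/-- At the start, the professor is at the base and no box has been dumped. -/
def start : State := ⟨0, false, 0, {0}⟩

/-- The points passed when walking `d` miles from `p`. -/
def stretch (p : Circuit) (d : ℝ) : Set Circuit :=
  (fun x : ℝ => p + (x : Circuit)) '' Set.uIcc 0 d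

/-- `Take s D`: in state `s` a sealed box is available at the professor's place, and `D` are the
dumps that remain when this box is taken. At the base the supply is unlimited. -/
inductive Take : State → Multiset Circuit → Prop
  | base (c : Bool) (D : Multiset Circuit) (S : Set Circuit) : Take ⟨0, c, D, S⟩ D
  | dumped (p : Circuit) (c : Bool) (D : Multiset Circuit) (S : Set Circuit) :
      Take ⟨p, c, p ::ₘ D, S⟩ D

/-- The effect of one move. The professor carries rations for at most two days. By day he
carries the unsealed box he is eating from, so he carries at most one sealed box. -/
inductive Step : State → Move → State → Prop
  | walk (s : State) (d : ℝ) :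
      Step s (.walk d)
        ⟨s.place + (d : Circuit), s.carrying, s.dumps, s.seen ∪ stretch s.place d⟩
  | pickUp (s : State) (D : Multiset Circuit) (free : s.carrying = false) (h : Take s D) :
      Step s .pickUp ⟨s.place, true, D, s.seen⟩
  | dump (s : State) (h : s.carrying = true) :
      Step s .dump ⟨s.place, false, s.place ::ₘ s.dumps, s.seen⟩

/-- Performing a list of moves one after the other. -/
inductive Steps : State → List Move → State → Prop
  | nil (s : State) : Steps s [] s
  | cons {s t u : State} {m : Move} {l : List Move} (h : Step s m t) (h' : Steps t l u) :
      Steps s (m :: l) u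

/-- Unsealing a box: either the box the professor is carrying, or a box at his place. -/
inductive Unseal : State → State → Prop
  | carried (s : State) (h : s.carrying = true) :
      Unseal s ⟨s.place, false, s.dumps, s.seen⟩
  | lying (s : State) (D : Multiset Circuit) (h : Take s D) :
      Unseal s ⟨s.place, s.carrying, D, s.seen⟩

/-- The number of miles walked in a move. -/
def Move.miles : Move → ℝ
  | .walk d => |d|
  | .pickUp => 0
  | .dump => 0

/-- The number of miles walked in a day. -/
def miles (day : List Move) : ℝ := (day.map Move.miles).sum

/-- One day: at dawn one box is unsealed; on its ration the professor walks at most twenty miles,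
and what is left of it is lost at night. Nothing is unsealed at any other time. -/
def Day (s : State) (day : List Move) (t : State) : Prop :=
  ∃ s', Unseal s s' ∧ Steps s' day t ∧ miles day ≤ 20

/-- A plan lists the moves of day 1, day 2, and so on. `Run s plan t`: starting at dawn in
state `s`, the plan can be carried out and leads to state `t`. -/
inductive Run : State → List (List Move) → State → Prop
  | nil (s : State) : Run s [] s
  | cons {s t u : State} {day : List Move} {plan : List (List Move)}
      (h : Day s day t) (h' : Run t plan u) : Run s (day :: plan) u

/-- The time a plan takes, in days: every day but the last counts for a whole day, and the last
one for the time that is needed to walk its miles, at twenty miles a day. -/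
noncomputable def duration : List (List Move) → ℝ
  | [] => 0
  | [day] => miles day / 20
  | _ :: day :: plan => 1 + duration (day :: plan)

/-- The plan can be carried out from the start, every point of the circuit is visited, and the
professor ends at the base. -/
def CompletesCircuit (plan : List (List Move)) : Prop :=
  ∃ t, Run start plan t ∧ t.place = 0 ∧ t.seen = Set.univ

open Move in
/-- The plan of `23 + 25 / 116` days, with one line of moves for each day. -/
noncomputable def dawnPlan : List (List Move) :=
  [ [pickUp, walk (250 / 29), dump, walk (-250 / 29),
      pickUp, walk (-20 / 29), dump, walk (20 / 29),
      pickUp, walk (-20 / 29), dump, walk (20 / 29)],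
    [pickUp, walk (-90 / 29), dump, walk (70 / 29), pickUp, walk (-100 / 29), dump,
      walk (100 / 29), pickUp, walk (-100 / 29), dump, walk (120 / 29)],
    [pickUp, walk (-10), dump, walk 10],
    [pickUp, walk (-320 / 29), dump, walk (30 / 29), pickUp, walk (-30 / 29), dump,
      walk (200 / 29)],
    [pickUp, walk (-390 / 29), dump, walk (190 / 29)],
    [pickUp, walk (-385 / 29), dump, walk (195 / 29)],
    [walk (420 / 29), pickUp, walk (-35 / 29), dump, walk (125 / 29)],
    [pickUp, walk (270 / 29), dump, walk (-20 / 29), pickUp, walk (20 / 29), dump,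
      walk (-270 / 29)],
    [pickUp, walk 10, dump, walk (-10)],
    [pickUp, walk 10, dump, walk (-10)],
    [pickUp, walk 10, dump, walk (-10)],
    [pickUp, walk 10, dump, walk (-10)],
    [pickUp, walk 10, dump, walk (-10)],
    [pickUp, walk (715 / 58), dump, walk (-135 / 58), pickUp, walk (135 / 58), dump,
      walk (-175 / 58)],
    [pickUp, walk (300 / 29), dump, walk (-280 / 29)],
    [pickUp, walk (285 / 29), dump, walk (-5 / 29), pickUp, walk (5 / 29), dump,
      walk (-285 / 29)],
    [pickUp, walk (1295 / 116), dump, walk (-1025 / 116)],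
    [pickUp, walk (655 / 58), dump, walk (-285 / 116), pickUp, walk (285 / 116), dump,
      walk (-110 / 29)],
    [pickUp, walk (345 / 29), dump, walk (-235 / 29)],
    [pickUp, walk (350 / 29), dump, walk (-115 / 29), pickUp, walk (115 / 29)],
    [pickUp, walk 20],
    [walk 20],
    [walk 20],
    [walk (125 / 29)] ]

end MountainCircuit

/-!
The optimal plan is carried out by computation: all its lengths are multiples of `1 / 116` mile, so
a record of the states by integers (`Sketch`) can be evaluated, and the evaluation is sound
(`Sketch.Shows.run`).

For the lower bound, take a day's walk as the unit of length, so that the circuit has length `5`,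
and lift the walk to the line (`lift_plan`). A walk that covers a whole period passes the point
opposite to the base; by reflection it may be assumed to get there for the first time on the near
side, that of increasing mile points (`exists_opposite`). Up to that arrival the expedition splits
into what happens on the near and on the far side of the base (`Splits`), and on each side the
length walked up to the last dawn is bounded below by a potential: the total value of the boxes,
under a convex weight depending on their distances from the base, plus a value of the place where
the professor is. A day that leads from distance `p` to distance `q` turns back at distance at most
`(1 + p + q) / 2`, which bounds by convexity what it can add to the value of the boxes
(`Side.weight`); hence a potential is admissible if a `DayCondition` holds, an inequality for
piecewise linear functions of `p` and `q` (`Side.potential_le`). The potential `wBoth`, `vBoth` is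
used on either side. It is too weak for the cases close to the optimal plan. On the far side the
professor has to come back after dumping his farthest box, and two-phase potentials account for that
(`Side.far_le`, `Side.deep_le`). On the near side there are two sharp potentials, for expeditions
with and without a dawn in the zone from `21 / 20` to `11 / 8` (`Side.near_le`).

After the arrival, boxes are needed on the dawns to come until the base is reached, and before
that they can only come from those that are available at the arrival. This yields two boxes, or
three if the arrival is in the second half of the day, at controlled distances from the opposite
point (`Onward`, `Onward.exists_boxes`). According to the halves of the circuit in which they lie,
the potentials give a lower bound for the number of days before the arrival (the lemmas on `Costs`),
and what remains is at least `5 / 2`. If all these boxes lie on the near side, then either the way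
on is long, or the professor turns back after the arrival and the rest of the far side was explored
before, which is costly as well (`Onward.ending`). In the sharp case, one box near the opposite
point on the near side and two on the far side, an arrival at time `t` of a day with `t < 83 / 116`
needs more than twenty days before, while for `t ≥ 83 / 116` it needs more than nineteen, and then
`20 + t + 5 / 2 ≥ 23 + 25 / 116` (`Costs.main_case`, `not_completed`).
-/

namespace MountainCircuit

/-! ### Potentials on one side of the base -/

/-- A weight gives each sealed box a value depending on its distance from the base: it vanishes
at the base, is convex, and grows at least at the rate `2` at which carrying one box per walk out
and back costs walking time. -/
structure IsWeight (W : ℝ → ℝ) : Prop where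
  convex : ConvexOn ℝ Set.univ W
  slope : ∀ {x y : ℝ}, x ≤ y → 2 * (y - x) ≤ W y - W x
  zero : W 0 = 0

/-- The total value of a collection of boxes. -/
noncomputable def tot (W : ℝ → ℝ) (M : Multiset ℝ) : ℝ := (M.map W).sum

/-- The box that is being carried, as a collection of at most one box. -/
def load (c : Bool) (x : ℝ) : Multiset ℝ := if c then {x} else 0

@[simp] lemma tot_zero (W : ℝ → ℝ) : tot W 0 = 0 := by simp [tot]

@[simp] lemma tot_cons (W : ℝ → ℝ) (x : ℝ) (M : Multiset ℝ) :
    tot W (x ::ₘ M) = W x + tot W M := by simp [tot]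

@[simp] lemma tot_add (W : ℝ → ℝ) (M N : Multiset ℝ) : tot W (M + N) = tot W M + tot W N := by
  simp [tot]

@[simp] lemma tot_load_true (W : ℝ → ℝ) (x : ℝ) : tot W (load true x) = W x := by
  simp [tot, load]

@[simp] lemma tot_load_false (W : ℝ → ℝ) (x : ℝ) : tot W (load false x) = 0 := by
  simp [load]

lemma tot_nonneg {W : ℝ → ℝ} {M : Multiset ℝ} (h : ∀ b ∈ M, 0 ≤ W b) : 0 ≤ tot W M := by
  apply Multiset.sum_nonneg
  simpa [tot] using h

lemma tot_le_tot {W U : ℝ → ℝ} {M : Multiset ℝ} (h : ∀ b ∈ M, W b ≤ U b) :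
    tot W M ≤ tot U M := Multiset.sum_map_le_sum_map _ _ h

lemma tot_mono_of_le {W : ℝ → ℝ} {M N : Multiset ℝ} (hMN : M ≤ N) (h : ∀ b ∈ N, 0 ≤ W b) :
    tot W M ≤ tot W N := by
  obtain ⟨K, rfl⟩ := Multiset.le_iff_exists_add.mp hMN
  have := tot_nonneg (W := W) (M := K) fun b hb => h b (by simp [hb])
  simpa using this

namespace IsWeight

variable {W : ℝ → ℝ}

lemma mono (h : IsWeight W) {x y : ℝ} (hxy : x ≤ y) : W x ≤ W y := by
  have := h.slope hxy
  linarith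

lemma nonneg (h : IsWeight W) {x : ℝ} (hx : 0 ≤ x) : 0 ≤ W x := by
  simpa [h.zero] using h.mono hx

lemma two_mul_le (h : IsWeight W) {x : ℝ} (hx : 0 ≤ x) : 2 * x ≤ W x := by
  simpa [h.zero] using h.slope hx

/-- The increments of a convex function over intervals of a fixed length are monotone. -/
lemma increment_le (h : IsWeight W) {x m d : ℝ} (hxm : x ≤ m) (hd : 0 ≤ d) :
    W (x + d) - W x ≤ W (m + d) - W m := by
  rcases hd.eq_or_lt with rfl | hd
  · simp
  rcases hxm.eq_or_lt with rfl | hxm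
  · rfl
  have hs : 0 < m + d - x := by linarith
  have h1 := h.convex.2 (Set.mem_univ x) (Set.mem_univ (m + d))
    (div_nonneg (by linarith : 0 ≤ m - x) hs.le) (div_nonneg hd.le hs.le) (by field_simp; ring)
  have h2 := h.convex.2 (Set.mem_univ x) (Set.mem_univ (m + d))
    (div_nonneg hd.le hs.le) (div_nonneg (by linarith : 0 ≤ m - x) hs.le) (by field_simp; ring)
  have e1 : (m - x) / (m + d - x) * x + d / (m + d - x) * (m + d) = x + d := by
    field_simp; ring
  have e2 : d / (m + d - x) * x + (m - x) / (m + d - x) * (m + d) = m := by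
    field_simp; ring
  simp only [smul_eq_mul] at h1 h2
  rw [e1] at h1
  rw [e2] at h2
  have e3 : (m - x) / (m + d - x) * W x + d / (m + d - x) * W (m + d)
      + (d / (m + d - x) * W x + (m - x) / (m + d - x) * W (m + d)) = W x + W (m + d) := by
    field_simp; ring
  linarith

end IsWeight

/-- The part of an expedition that takes place on one side of the base, as long as the opposite
point of the circuit is not passed. `Side p B A x c M a` says that at the last dawn the place was
at distance `p` from the base and, after unsealing, `B` were the distances of all sealed boxes,
that `A` is the length walked on this side on all previous days, that now the distance is `x`,
`c` tells whether a box is carried, `M` are the distances of the boxes lying around, and `a` is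
the length walked on this side since dawn. What happens on the other side is seen as happening at
distance `0`. The unit of length is a day's walk. -/
inductive Side : ℝ → Multiset ℝ → ℝ → ℝ → Bool → Multiset ℝ → ℝ → Prop
  | start : Side 0 0 0 0 false 0 0
  | walk {p B A x c M a} (y : ℝ) (h : Side p B A x c M a) (hy : 0 ≤ y) (ha : a + |y - x| ≤ 1) :
      Side p B A y c M (a + |y - x|)
  | pick {p B A x M a} (h : Side p B A x false (x ::ₘ M) a) : Side p B A x true M a
  | pickBase {p B A M a} (h : Side p B A 0 false M a) : Side p B A 0 true M a
  | dump {p B A x M a} (h : Side p B A x true M a) : Side p B A x false (x ::ₘ M) a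
  | carried {p B A x M a} (h : Side p B A x true M a) : Side x M (A + a) x false M 0
  | lying {p B A x c M a} (h : Side p B A x c (x ::ₘ M) a) :
      Side x (M + load c x) (A + a) x c M 0
  | base {p B A c M a} (h : Side p B A 0 c M a) : Side 0 (M + load c 0) (A + a) 0 c M 0

/-- What is used about the transition from the dawn at distance `p` with boxes `B` to the next
dawn at distance `q` with boxes `B'`, when `a` is walked in between. -/
structure DayStep (p : ℝ) (B : Multiset ℝ) (q : ℝ) (B' : Multiset ℝ) (a : ℝ) : Prop where
  nonneg : 0 ≤ q
  dist : |q - p| ≤ a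
  le_one : a ≤ 1
  boxes : ∀ b ∈ B', 0 ≤ b
  weight : ∀ W, IsWeight W → tot W B' ≤ tot W B - W p + W ((a + p + q) / 2) - W q
  reach : ∀ z, 0 < z → (∀ b ∈ B, b < z) → (∀ b ∈ B', b < z) ∨ 2 * z ≤ a + p + q

namespace Side

variable {p A x a : ℝ} {B M : Multiset ℝ} {c : Bool}

lemma dawn_nonneg (h : Side p B A x c M a) : 0 ≤ p ∧ 0 ≤ x := by
  induction h <;> simp_all

lemma dist (h : Side p B A x c M a) : |x - p| ≤ a := by
  induction h with
  | walk y h hy ha ih =>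
    rename_i p B A x c M a
    have := abs_sub_le y x p
    linarith
  | _ => simp_all

lemma le_one (h : Side p B A x c M a) : a ≤ 1 := by
  induction h <;> simp_all

lemma nonneg (h : Side p B A x c M a) : 0 ≤ a := (abs_nonneg _).trans h.dist

lemma boxes_nonneg (h : Side p B A x c M a) : ∀ b ∈ M, 0 ≤ b := by
  induction h with
  | dump h ih => simpa using ⟨h.dawn_nonneg.2, ih⟩
  | _ => simp_all

lemma walked_nonneg (h : Side p B A x c M a) : 0 ≤ A := by
  induction h with
  | carried h ih => have := h.nonneg; linarith
  | lying h ih => have := h.nonneg; linarith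
  | base h ih => have := h.nonneg; linarith
  | _ => simp_all

lemma load_nonneg (h : Side p B A x c M a) : ∀ b ∈ M + load c x, 0 ≤ b := by
  intro b hb
  rcases Multiset.mem_add.mp hb with hb | hb
  · exact h.boxes_nonneg b hb
  · cases c <;> simp [load] at hb
    rw [hb]
    exact h.dawn_nonneg.2

/-- The value of the boxes gained since dawn is bounded by what one walk of length `a` from `p`
to `x` can achieve: its turning point is at distance at most `(a + p + x) / 2`. -/
lemma weight {W : ℝ → ℝ} (hW : IsWeight W) (h : Side p B A x c M a) :
    tot W (M + load c x) + W p - W ((a + p + x) / 2) ≤ tot W B := by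
  induction h with
  | start => simp [hW.zero]
  | walk y h hy ha ih =>
    rename_i p B A x c M a
    have h1 := abs_le.mp h.dist
    have hm : W ((a + p + x) / 2) ≤ W ((a + |y - x| + p + y) / 2) := by
      apply hW.mono
      have := neg_abs_le (y - x)
      linarith
    cases c with
    | false => simp at ih ⊢; linarith
    | true =>
      simp at ih ⊢
      rcases le_total x y with hxy | hxy
      · have := hW.increment_le (x := x) (m := (a + p + x) / 2) (d := y - x) (by linarith)
          (by linarith)
        rw [abs_of_nonneg (by linarith)]
        rw [show (a + (y - x) + p + y) / 2 = (a + p + x) / 2 + (y - x) by ring]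
        rw [show x + (y - x) = y by ring] at this
        linarith
      · have := hW.mono hxy
        linarith
  | pick h ih => simp at ih ⊢; linarith
  | pickBase h ih => simp [hW.zero] at ih ⊢; linarith
  | dump h ih => simp at ih ⊢; linarith
  | carried h ih => simp
  | lying h ih => simp
  | base h ih => simp

/-- A box at distance `z` must have been carried there, or been there at dawn. -/
lemma reach {z : ℝ} (hz : 0 < z) (h : Side p B A x c M a) (hB : ∀ b ∈ B, b < z) :
    ((∀ b ∈ M, b < z) ∧ (c = true → x < z)) ∨ 2 * z ≤ a + p + x := by
  induction h with
  | start => simp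
  | walk y h hy ha ih =>
    rename_i p B A x c M a
    rcases ih hB with ih | ih
    · by_cases hyz : y < z
      · exact .inl ⟨ih.1, fun _ => hyz⟩
      · right
        have h1 := abs_le.mp h.dist
        have h2 := le_abs_self (y - x)
        linarith
    · right
      have := neg_abs_le (y - x)
      linarith
  | pick h ih => simpa [and_comm] using ih hB
  | pickBase h ih => have := ih hB; simp_all
  | dump h ih => simpa [and_comm] using ih hB
  | carried h ih => left; simp_all
  | lying h ih =>
    rename_i c M a
    left
    refine ⟨fun b hb => hB b (by simp [hb]), ?_⟩
    rintro rfl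
    exact hB _ (by simp [load])
  | base h ih =>
    left
    exact ⟨fun b hb => hB b (by simp [hb]), fun _ => hz⟩

/-- Truncated at `θ`, the value of the boxes does not increase during a day that ends beyond `θ`
by at least the length walked: such a day never leads back to a distance below `θ`. -/
lemma truncated {W : ℝ → ℝ} (hW : IsWeight W) {θ : ℝ} (hθ : 0 ≤ θ) (h : Side p B A x c M a) :
    tot (fun y => W (min y θ)) (M + load c x) ≤ tot W B ∨ x - θ < a := by
  have key : ∀ N : Multiset ℝ, tot (fun y => W (min y θ)) N ≤ tot W N := fun N =>
    tot_le_tot fun b _ => hW.mono (min_le_left _ _)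
  induction h with
  | start => simp
  | walk y h hy ha ih =>
    rename_i p B A x c M a
    have h0 := h.nonneg
    have h2 := le_abs_self (y - x)
    rcases ih with ih | ih
    · by_cases hyθ : y < θ
      · right
        have := abs_nonneg (y - x)
        linarith
      · by_cases hxθ : x < θ
        · right; linarith
        · left
          cases c with
          | false => simpa using ih
          | true =>
            simp [min_eq_right (not_lt.mp hyθ), min_eq_right (not_lt.mp hxθ)] at ih ⊢
            exact ih
    · right; linarith
  | pick h ih => simp at ih ⊢; rcases ih with ih | ih <;> [left; right] <;> linarith
  | pickBase h ih => simp [min_eq_left hθ, hW.zero] at ih ⊢; exact ih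
  | dump h ih => simp at ih ⊢; rcases ih with ih | ih <;> [left; right] <;> linarith
  | carried h ih => left; simpa using key _
  | lying h ih => left; exact key _
  | base h ih => left; exact key _

/-- Induction over the dawns. -/
theorem dawn_induction {P : ℝ → Multiset ℝ → ℝ → Prop} (h0 : P 0 0 0)
    (hs : ∀ p B A q B' a, 0 ≤ p → P p B A → DayStep p B q B' a → P q B' (A + a))
    (h : Side p B A x c M a) : P p B A := by
  have key : ∀ {p B A x c M a B'} (_ : Side p B A x c M a),
      (∀ W, IsWeight W → tot W (M + load c x) = tot W B' + W x) →
      (∀ b ∈ B', b ∈ M + load c x) → DayStep p B x B' a := by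
    intro p B A x c M a B' h h1 h2
    refine ⟨h.dawn_nonneg.2, h.dist, h.le_one, fun b hb => h.load_nonneg b (h2 b hb), ?_, ?_⟩
    · intro W hW
      have := h.weight hW
      rw [h1 W hW] at this
      linarith
    · intro z hz hB
      refine (h.reach hz hB).imp (fun hr b hb => ?_) id
      rcases Multiset.mem_add.mp (h2 b hb) with hb | hb
      · exact hr.1 b hb
      · cases c <;> simp [load] at hb
        rw [hb]
        exact hr.2 rfl
  induction h with
  | start => exact h0
  | walk y h hy ha ih => exact ih
  | pick h ih => exact ih
  | pickBase h ih => exact ih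
  | dump h ih => exact ih
  | carried h ih =>
    exact hs _ _ _ _ _ _ h.dawn_nonneg.1 ih (key h (by intro W _; simp) (by intro b hb; simp [hb]))
  | lying h ih =>
    refine hs _ _ _ _ _ _ h.dawn_nonneg.1 ih (key h (by intro W _; simp; ring) ?_)
    intro b hb
    simp only [Multiset.mem_add, Multiset.mem_cons] at hb ⊢
    tauto
  | base h ih =>
    exact hs _ _ _ _ _ _ h.dawn_nonneg.1 ih
      (key h (by intro W hW; simp [hW.zero]) (by intro b hb; exact hb))

end Side

/-! ### Potentials and the daily gain -/

/-- The piecewise linear function that is `0` up to `h` and has slope `1` beyond. -/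
noncomputable def hinge (h x : ℝ) : ℝ := max (x - h) 0

lemma hinge_of_le {h x : ℝ} (hx : x ≤ h) : hinge h x = 0 := max_eq_right (by linarith)

lemma hinge_of_ge {h x : ℝ} (hx : h ≤ x) : hinge h x = x - h := max_eq_left (by linarith)

lemma hinge_mono (h : ℝ) {x y : ℝ} (hxy : x ≤ y) : hinge h x ≤ hinge h y :=
  max_le_max (by linarith) le_rfl

lemma isWeight_two_mul : IsWeight fun x => 2 * x where
  convex := ((convexOn_id convex_univ).smul (by norm_num : (0 : ℝ) ≤ 2)).congr fun x _ => by simp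
  slope h := by linarith
  zero := by simp

lemma IsWeight.add_hinge {W : ℝ → ℝ} (hW : IsWeight W) {k h : ℝ} (hk : 0 ≤ k) (hh : 0 ≤ h) :
    IsWeight fun x => W x + k * hinge h x where
  convex := by
    refine hW.convex.add (ConvexOn.smul hk ?_)
    exact ((convexOn_id convex_univ).sub (concaveOn_const h convex_univ)).sup
      (convexOn_const 0 convex_univ)
  slope {x y} hxy := by
    have h1 := hW.slope hxy
    have h2 := mul_le_mul_of_nonneg_left (hinge_mono h hxy) hk
    linarith
  zero := by
    have : hinge h 0 = 0 := max_eq_right (by linarith)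
    simp [hW.zero, this]

/-- A day's walk from `p` to `q` pays for the change of the value `V` of the place to the value
`V'`, in addition to the value of the boxes measured by the weight `W`. -/
def DayCondition (W V V' : ℝ → ℝ) (p q : ℝ) : Prop :=
  V' q - V p ≤ W p + W q + 1 - W ((1 + p + q) / 2)

namespace DayStep

variable {W V V' : ℝ → ℝ} {p q a : ℝ} {B B' : Multiset ℝ}

lemma dist_le_one (h : DayStep p B q B' a) : |q - p| ≤ 1 := h.dist.trans h.le_one

lemma full_day (hW : IsWeight W) (h : DayStep p B q B' a) :
    tot W B' + W p + W q + 1 - W ((1 + p + q) / 2) ≤ tot W B + a := by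
  have h1 := h.weight W hW
  have h2 := hW.slope (x := (a + p + q) / 2) (y := (1 + p + q) / 2) (by linarith [h.le_one])
  linarith

lemma gain (hW : IsWeight W) (h : DayStep p B q B' a) (hd : DayCondition W V V' p q) {A R : ℝ}
    (hA : tot W B + V p + R ≤ A) : tot W B' + V' q + R ≤ A + a := by
  have := h.full_day hW
  unfold DayCondition at hd
  linarith

end DayStep

/-- If every day pays for the change of the potential, the walk on one side of the base is at
least as long as the potential. -/
theorem Side.potential_le {W V : ℝ → ℝ} (hW : IsWeight W) (hV : V 0 = 0)
    (hd : ∀ p q, 0 ≤ p → 0 ≤ q → |q - p| ≤ 1 → DayCondition W V V p q)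
    {p A x a : ℝ} {B M : Multiset ℝ} {c : Bool} (h : Side p B A x c M a) :
    tot W B + V p ≤ A := by
  refine h.dawn_induction (P := fun p B A => tot W B + V p ≤ A) (by simp [hV]) ?_
  intro p B A q B' a hp hA hday
  simpa using hday.gain hW (hd p q hp hday.nonneg hday.dist_le_one) (R := 0) (by simpa using hA)

/-! ### A potential for both sides -/

/-- A weight that is used on both sides of the base. Like the other weights, it has its breakpoints
and slopes from the dual of the linear program that minimizes the walks needed to bring boxes out
to given distances. -/
noncomputable def wBoth (x : ℝ) : ℝ :=
  2 * x + 10 / 7 * hinge (1 / 2) x + 8 / 7 * hinge (3 / 4) x + 32 / 7 * hinge (9 / 8) x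

/-- The value of the place that goes with `wBoth`. -/
noncomputable def vBoth (x : ℝ) : ℝ :=
  2 / 7 * x + 6 / 7 * hinge (1 / 2) x - 8 / 7 * hinge (3 / 4) x + 32 / 7 * hinge (9 / 8) x
    + 64 / 7 * hinge (17 / 8) x

lemma isWeight_wBoth : IsWeight wBoth :=
  ((isWeight_two_mul.add_hinge (by norm_num) (by norm_num)).add_hinge (by norm_num)
    (by norm_num)).add_hinge (by norm_num) (by norm_num)

lemma vBoth_zero : vBoth 0 = 0 := by
  unfold vBoth hinge
  norm_num

lemma both_cases (x : ℝ) :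
    (x ≤ 1 / 2 ∧ wBoth x = 2 * x ∧ vBoth x = 2 / 7 * x) ∨
    (1 / 2 ≤ x ∧ x ≤ 3 / 4 ∧ wBoth x = 24 / 7 * x - 5 / 7 ∧ vBoth x = 8 / 7 * x - 3 / 7) ∨
    (3 / 4 ≤ x ∧ x ≤ 9 / 8 ∧ wBoth x = 32 / 7 * x - 11 / 7 ∧ vBoth x = 3 / 7) ∨
    (9 / 8 ≤ x ∧ x ≤ 17 / 8 ∧ wBoth x = 64 / 7 * x - 47 / 7 ∧ vBoth x = 32 / 7 * x - 33 / 7) ∨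
    (17 / 8 ≤ x ∧ wBoth x = 64 / 7 * x - 47 / 7 ∧ vBoth x = 96 / 7 * x - 169 / 7) := by
  unfold wBoth vBoth
  rcases le_total x (1 / 2) with h1 | h1
  · left
    rw [hinge_of_le (by linarith), hinge_of_le (by linarith), hinge_of_le (by linarith),
      hinge_of_le (by linarith)]
    exact ⟨h1, by ring, by ring⟩
  rcases le_total x (3 / 4) with h2 | h2
  · right; left
    rw [hinge_of_ge h1, hinge_of_le h2, hinge_of_le (by linarith), hinge_of_le (by linarith)]
    exact ⟨h1, h2, by ring, by ring⟩
  rcases le_total x (9 / 8) with h3 | h3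
  · right; right; left
    rw [hinge_of_ge h1, hinge_of_ge h2, hinge_of_le h3, hinge_of_le (by linarith)]
    exact ⟨h2, h3, by ring, by ring⟩
  rcases le_total x (17 / 8) with h4 | h4
  · right; right; right; left
    rw [hinge_of_ge h1, hinge_of_ge h2, hinge_of_ge h3, hinge_of_le h4]
    exact ⟨h3, h4, by ring, by ring⟩
  · right; right; right; right
    rw [hinge_of_ge h1, hinge_of_ge h2, hinge_of_ge h3, hinge_of_ge h4]
    exact ⟨h4, by ring, by ring⟩

lemma vBoth_mono {x y : ℝ} (h : x ≤ y) : vBoth x ≤ vBoth y := by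
  rcases both_cases x with ⟨_, _, e⟩ | ⟨_, _, _, e⟩ | ⟨_, _, _, e⟩ | ⟨_, _, _, e⟩ | ⟨_, _, e⟩ <;>
  rcases both_cases y with ⟨_, _, e'⟩ | ⟨_, _, _, e'⟩ | ⟨_, _, _, e'⟩ | ⟨_, _, _, e'⟩ |
    ⟨_, _, e'⟩ <;>
  rw [e, e'] <;> linarith

lemma wBoth_ge (x : ℝ) : 2 * x ≤ wBoth x ∧ 24 / 7 * x - 5 / 7 ≤ wBoth x ∧
    32 / 7 * x - 11 / 7 ≤ wBoth x ∧ 64 / 7 * x - 47 / 7 ≤ wBoth x := by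
  rcases both_cases x with ⟨_, e, _⟩ | ⟨_, _, e, _⟩ | ⟨_, _, e, _⟩ | ⟨_, _, e, _⟩ | ⟨_, e, _⟩ <;>
  rw [e] <;> refine ⟨?_, ?_, ?_, ?_⟩ <;> linarith

/-- For each piece of the weight at the turning point, the condition separates into one
inequality for each end of the day's walk; these are piecewise linear in one variable. -/
lemma dayCondition_both (p q : ℝ) (hp : 0 ≤ p) (hq : 0 ≤ q) (hpq : |q - p| ≤ 1) :
    DayCondition wBoth vBoth vBoth p q := by
  have hpq := abs_le.mp hpq
  have f : 0 ≤ wBoth p + vBoth p - p ∧ 0 ≤ wBoth p + vBoth p - 12 / 7 * p ∧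
      0 ≤ wBoth p + vBoth p - 16 / 7 * p ∧ -8 / 7 ≤ wBoth p + vBoth p - 32 / 7 * p ∧
      (9 / 8 ≤ p → -80 / 7 ≤ wBoth p + vBoth p - 96 / 7 * p) := by
    rcases both_cases p with ⟨_, e, e'⟩ | ⟨_, _, e, e'⟩ | ⟨_, _, e, e'⟩ | ⟨_, _, e, e'⟩ |
      ⟨_, e, e'⟩ <;>
    rw [e, e'] <;> refine ⟨?_, ?_, ?_, ?_, fun _ => ?_⟩ <;> linarith
  have g : (q ≤ 17 / 8 → 0 ≤ wBoth q - vBoth q - q ∧ 0 ≤ wBoth q - vBoth q - 12 / 7 * q ∧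
      -2 / 7 ≤ wBoth q - vBoth q - 16 / 7 * q ∧ -2 ≤ wBoth q - vBoth q - 32 / 7 * q) ∧
      (17 / 8 ≤ q → 122 / 7 ≤ wBoth q - vBoth q + 32 / 7 * q) := by
    rcases both_cases q with ⟨_, e, e'⟩ | ⟨_, _, e, e'⟩ | ⟨_, _, e, e'⟩ | ⟨_, _, e, e'⟩ |
      ⟨_, e, e'⟩ <;>
    rw [e, e'] <;> refine ⟨fun _ => ⟨?_, ?_, ?_, ?_⟩, fun _ => ?_⟩ <;> linarith
  obtain ⟨f1, f2, f3, f4, f5⟩ := f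
  unfold DayCondition
  rcases le_total q (17 / 8) with hq' | hq'
  · obtain ⟨g1, g2, g3, g4⟩ := g.1 hq'
    rcases both_cases ((1 + p + q) / 2) with ⟨_, e, _⟩ | ⟨_, _, e, _⟩ | ⟨_, _, e, _⟩ |
      ⟨_, _, e, _⟩ | ⟨_, e, _⟩ <;>
    rw [e] <;> linarith
  · have g1 := g.2 hq'
    have f5 := f5 (by linarith)
    rcases both_cases ((1 + p + q) / 2) with ⟨_, e, _⟩ | ⟨_, _, e, _⟩ | ⟨_, _, e, _⟩ |
      ⟨_, _, e, _⟩ | ⟨_, e, _⟩ <;>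
    rw [e] <;> linarith

lemma Side.wBoth_le {p A x a : ℝ} {B M : Multiset ℝ} {c : Bool} (h : Side p B A x c M a) :
    tot wBoth B + vBoth p ≤ A :=
  h.potential_le isWeight_wBoth vBoth_zero dayCondition_both

/-! ### Two phases on the far side -/

/-- What is conceded, once a box lies far out, for the place from which the professor has to come
back: with the weight `2 * x` for the boxes, no day decreases it by more than it pays for. -/
noncomputable def slack (q : ℝ) : ℝ := max q (3 * q - 2)

lemma slack_cases (q : ℝ) : (q ≤ 1 ∧ slack q = q) ∨ (1 ≤ q ∧ slack q = 3 * q - 2) := by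
  unfold slack
  rcases le_total q 1 with h | h
  · exact .inl ⟨h, max_eq_left (by linarith)⟩
  · exact .inr ⟨h, max_eq_right (by linarith)⟩

lemma dayCondition_slack (p q : ℝ) (hq : 0 ≤ q) (hpq : |q - p| ≤ 1) :
    DayCondition (fun x => 2 * x) (fun x => -slack x) (fun x => -slack x) p q := by
  have hpq := abs_le.mp hpq
  simp only [DayCondition]
  rcases slack_cases p with ⟨_, e⟩ | ⟨_, e⟩ <;> rcases slack_cases q with ⟨_, e'⟩ | ⟨_, e'⟩ <;>
  rw [e, e'] <;> linarith

/-- The value of a collection of boxes, one of them at distance at least `z`, under any weight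
exceeds its value under the weight `2 * x` by at least the excess at `z`. -/
lemma tot_two_mul_le {W : ℝ → ℝ} (hW : IsWeight W) {B : Multiset ℝ} (hB : ∀ b ∈ B, 0 ≤ b)
    {z b : ℝ} (hb : b ∈ B) (hz : z ≤ b) : tot (fun x => 2 * x) B + (W z - 2 * z) ≤ tot W B := by
  obtain ⟨B, rfl⟩ := Multiset.exists_cons_of_mem hb
  have h1 : tot (fun x => 2 * x) B ≤ tot W B :=
    tot_le_tot fun b hb => hW.two_mul_le (hB b (by simp [hb]))
  have h2 := hW.slope hz
  simp only [tot_cons]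
  linarith

/-- Until a dawn finds a box at distance at least `z`, the potential given by `W` and `V` is
used; after that the boxes count only with weight `2 * x`, and the gain `R` at the change is
kept. -/
theorem Side.two_phase {W V : ℝ → ℝ} (hW : IsWeight W) (hV : V 0 = 0)
    (hd : ∀ p q, 0 ≤ p → 0 ≤ q → |q - p| ≤ 1 → DayCondition W V V p q) {z R : ℝ} (hz : 0 < z)
    (ht : ∀ p q, 2 * z - 1 ≤ p + q →
      R + W ((1 + p + q) / 2) ≤ V p + W p + W q + 1 + (W z - 2 * z) + slack q)
    {p A x a : ℝ} {B M : Multiset ℝ} {c : Bool} (h : Side p B A x c M a) :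
    tot W B + V p ≤ A ∧ ((∀ b ∈ B, b < z) ∨ tot (fun x => 2 * x) B - slack p + R ≤ A) := by
  refine h.dawn_induction (P := fun p B A => tot W B + V p ≤ A ∧
    ((∀ b ∈ B, b < z) ∨ tot (fun x => 2 * x) B - slack p + R ≤ A)) (by simp [hV]) ?_
  rintro p B A q B' a hp ⟨hA, hA'⟩ hday
  have hd' := hd p q hp hday.nonneg hday.dist_le_one
  refine ⟨by simpa using hday.gain hW hd' (R := 0) (by simpa using hA), ?_⟩
  rcases hA' with hB | hA'
  · rcases hday.reach z hz hB with hB' | hr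
    · exact .inl hB'
    · by_cases hB' : ∀ b ∈ B', b < z
      · exact .inl hB'
      · right
        push Not at hB'
        obtain ⟨b, hb, hzb⟩ := hB'
        have h1 := tot_two_mul_le hW hday.boxes hb hzb
        have h2 := hday.full_day hW
        have h3 := ht p q (by linarith [hday.le_one])
        linarith
  · right
    have := hday.gain isWeight_two_mul
      (dayCondition_slack p q hday.nonneg hday.dist_le_one) (R := R) (A := A) (by linarith)
    linarith

/-- The two-phase bound for a side on which the professor has not been since dawn. -/
theorem Side.two_phase_idle {W V : ℝ → ℝ} (hW : IsWeight W) (hV : V 0 = 0)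
    (hd : ∀ p q, 0 ≤ p → 0 ≤ q → |q - p| ≤ 1 → DayCondition W V V p q) {z R : ℝ} (hz : 0 < z)
    (ht : ∀ p q, 2 * z - 1 ≤ p + q →
      R + W ((1 + p + q) / 2) ≤ V p + W p + W q + 1 + (W z - 2 * z) + slack q)
    {A : ℝ} {B M : Multiset ℝ} {c : Bool} (h : Side 0 B A 0 c M 0) {b : ℝ} (hb : b ∈ M)
    (hzb : z ≤ b) : tot (fun x => 2 * x) M + R ≤ A := by
  have h1 := h.weight isWeight_two_mul
  have h2 : tot (fun x => 2 * x) (load c 0) = 0 := by cases c <;> simp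
  have h3 : slack 0 = 0 := by simp [slack]
  rw [tot_add, h2] at h1
  rcases (h.two_phase hW hV hd hz ht).2 with hB | hA
  · rcases h.reach hz hB with hM | hr
    · exact absurd (hM.1 b hb) (not_lt.mpr hzb)
    · linarith
  · norm_num at h1 h2
    linarith

/-- The far weight for the case that is sharp for the optimal plan. -/
noncomputable def wFar (x : ℝ) : ℝ := 2 * x + 12 / 7 * hinge (1 / 2) x + 4 / 7 * hinge (3 / 4) x

/-- The value of the place that goes with `wFar`. -/
noncomputable def vFar (x : ℝ) : ℝ :=
  1 / 7 * x + 10 / 7 * hinge (1 / 2) x + 4 / 7 * hinge (3 / 4) x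

lemma isWeight_wFar : IsWeight wFar :=
  (isWeight_two_mul.add_hinge (by norm_num) (by norm_num)).add_hinge (by norm_num) (by norm_num)

lemma vFar_zero : vFar 0 = 0 := by
  unfold vFar hinge
  norm_num

lemma far_cases (x : ℝ) :
    (x ≤ 1 / 2 ∧ wFar x = 2 * x ∧ vFar x = 1 / 7 * x) ∨
    (1 / 2 ≤ x ∧ x ≤ 3 / 4 ∧ wFar x = 26 / 7 * x - 6 / 7 ∧ vFar x = 11 / 7 * x - 5 / 7) ∨
    (3 / 4 ≤ x ∧ wFar x = 30 / 7 * x - 9 / 7 ∧ vFar x = 15 / 7 * x - 8 / 7) := by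
  unfold wFar vFar
  rcases le_total x (1 / 2) with h1 | h1
  · left
    rw [hinge_of_le (by linarith), hinge_of_le (by linarith)]
    exact ⟨h1, by ring, by ring⟩
  rcases le_total x (3 / 4) with h2 | h2
  · right; left
    rw [hinge_of_ge h1, hinge_of_le h2]
    exact ⟨h1, h2, by ring, by ring⟩
  · right; right
    rw [hinge_of_ge h1, hinge_of_ge h2]
    exact ⟨h2, by ring, by ring⟩

lemma dayCondition_far (p q : ℝ) (hp : 0 ≤ p) (hq : 0 ≤ q) (_ : |q - p| ≤ 1) :
    DayCondition wFar vFar vFar p q := by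
  have f : 0 ≤ wFar p + vFar p - p ∧ 0 ≤ wFar p + vFar p - 13 / 7 * p ∧
      0 ≤ wFar p + vFar p - 15 / 7 * p := by
    rcases far_cases p with ⟨_, e, e'⟩ | ⟨_, _, e, e'⟩ | ⟨_, e, e'⟩ <;>
    rw [e, e'] <;> refine ⟨?_, ?_, ?_⟩ <;> linarith
  have g : 0 ≤ wFar q - vFar q - q ∧ 0 ≤ wFar q - vFar q - 13 / 7 * q ∧
      -1 / 7 ≤ wFar q - vFar q - 15 / 7 * q := by
    rcases far_cases q with ⟨_, e, e'⟩ | ⟨_, _, e, e'⟩ | ⟨_, e, e'⟩ <;>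
    rw [e, e'] <;> refine ⟨?_, ?_, ?_⟩ <;> linarith
  unfold DayCondition
  rcases far_cases ((1 + p + q) / 2) with ⟨_, e, _⟩ | ⟨_, _, e, _⟩ | ⟨_, e, _⟩ <;>
  rw [e] <;> linarith [f.1, f.2.1, f.2.2, g.1, g.2.1, g.2.2]

lemma transition_far {z : ℝ} (p q : ℝ) (hpq : 2 * z - 1 ≤ p + q) :
    (60 * z - 50) / 7 + wFar ((1 + p + q) / 2) ≤
      vFar p + wFar p + wFar q + 1 + (wFar z - 2 * z) + slack q := by
  -- The multiplier of the constraint `2 * z - 1 ≤ p + q` is `22 / 7`.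
  have f : -1 ≤ wFar p + vFar p - 29 / 7 * p ∧ -10 / 7 ≤ wFar p + vFar p - 5 * p ∧
      -11 / 7 ≤ wFar p + vFar p - 37 / 7 * p := by
    rcases far_cases p with ⟨_, e, e'⟩ | ⟨_, _, e, e'⟩ | ⟨_, e, e'⟩ <;>
    rw [e, e'] <;> refine ⟨?_, ?_, ?_⟩ <;> linarith
  have g : -4 / 7 ≤ wFar q + slack q - 29 / 7 * q ∧ -15 / 14 ≤ wFar q + slack q - 5 * q ∧
      -9 / 7 ≤ wFar q + slack q - 37 / 7 * q := by
    rcases far_cases q with ⟨_, e, _⟩ | ⟨_, _, e, _⟩ | ⟨_, e, _⟩ <;>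
    rcases slack_cases q with ⟨_, e'⟩ | ⟨_, e'⟩ <;>
    rw [e, e'] <;> refine ⟨?_, ?_, ?_⟩ <;> linarith
  have k : 19 / 7 ≤ wFar z - 2 * z - (60 * z - 50) / 7 + 22 / 7 * (2 * z - 1) := by
    rcases far_cases z with ⟨_, e, _⟩ | ⟨_, _, e, _⟩ | ⟨_, e, _⟩ <;> rw [e] <;> linarith
  rcases far_cases ((1 + p + q) / 2) with ⟨_, e, _⟩ | ⟨_, _, e, _⟩ | ⟨_, e, _⟩ <;>
  rw [e] <;> linarith [f.1, f.2.1, f.2.2, g.1, g.2.1, g.2.2]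

lemma Side.far_le {A : ℝ} {B M : Multiset ℝ} {c : Bool} (h : Side 0 B A 0 c M 0) {z b : ℝ}
    (hz : 0 < z) (hb : b ∈ M) (hzb : z ≤ b) :
    tot (fun x => 2 * x) M + (60 * z - 50) / 7 ≤ A :=
  h.two_phase_idle isWeight_wFar vFar_zero dayCondition_far hz transition_far hb hzb

/-- The weight for boxes deep on the far side. -/
noncomputable def wDeep (x : ℝ) : ℝ := 2 * x + 2 * hinge (1 / 2) x

/-- The value of the place that goes with `wDeep`. -/
noncomputable def vDeep (x : ℝ) : ℝ := 2 * hinge (1 / 2) x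

lemma isWeight_wDeep : IsWeight wDeep :=
  isWeight_two_mul.add_hinge (by norm_num) (by norm_num)

lemma vDeep_zero : vDeep 0 = 0 := by
  unfold vDeep hinge
  norm_num

lemma deep_cases (x : ℝ) : (x ≤ 1 / 2 ∧ wDeep x = 2 * x ∧ vDeep x = 0) ∨
    (1 / 2 ≤ x ∧ wDeep x = 4 * x - 1 ∧ vDeep x = 2 * x - 1) := by
  unfold wDeep vDeep
  rcases le_total x (1 / 2) with h1 | h1
  · left
    rw [hinge_of_le h1]
    exact ⟨h1, by ring, by ring⟩
  · right
    rw [hinge_of_ge h1]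
    exact ⟨h1, by ring, by ring⟩

lemma dayCondition_deep (p q : ℝ) (hp : 0 ≤ p) (hq : 0 ≤ q) (_ : |q - p| ≤ 1) :
    DayCondition wDeep vDeep vDeep p q := by
  unfold DayCondition
  rcases deep_cases p with ⟨_, e1, e2⟩ | ⟨_, e1, e2⟩ <;>
  rcases deep_cases q with ⟨_, e3, e4⟩ | ⟨_, e3, e4⟩ <;>
  rcases deep_cases ((1 + p + q) / 2) with ⟨_, e5, _⟩ | ⟨_, e5, _⟩ <;>
  rw [e1, e2, e3, e4, e5] <;> linarith

lemma transition_deep {z : ℝ} (hz : 1 ≤ z) (p q : ℝ)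
    (hpq : 2 * z - 1 ≤ p + q) : (10 * z - 9) + wDeep ((1 + p + q) / 2) ≤
      vDeep p + wDeep p + wDeep q + 1 + (wDeep z - 2 * z) + slack q := by
  -- The multiplier of the constraint `2 * z - 1 ≤ p + q` is `4`.
  have f : -2 ≤ wDeep p + vDeep p - 6 * p := by
    rcases deep_cases p with ⟨_, e, e'⟩ | ⟨_, e, e'⟩ <;> rw [e, e'] <;> linarith
  have g : -2 ≤ wDeep q + slack q - 6 * q := by
    rcases deep_cases q with ⟨_, e, _⟩ | ⟨_, e, _⟩ <;>
    rcases slack_cases q with ⟨_, e'⟩ | ⟨_, e'⟩ <;> rw [e, e'] <;> linarith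
  rcases deep_cases z with ⟨_, e, _⟩ | ⟨_, e, _⟩ <;>
  rcases deep_cases ((1 + p + q) / 2) with ⟨_, e', _⟩ | ⟨_, e', _⟩ <;>
  rw [e, e'] <;> linarith

lemma Side.deep_le {A : ℝ} {B M : Multiset ℝ} {c : Bool} (h : Side 0 B A 0 c M 0) {z b : ℝ}
    (hz : 1 ≤ z) (hb : b ∈ M) (hzb : z ≤ b) :
    tot (fun x => 2 * x) M + (10 * z - 9) ≤ A :=
  h.two_phase_idle isWeight_wDeep vDeep_zero dayCondition_deep (by linarith) (transition_deep hz)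
    hb hzb

/-! ### The sharp potentials on the near side -/

/-- The near weight that is used as long as no dawn is spent in the zone from `21 / 20` to
`11 / 8`. -/
noncomputable def wNear (x : ℝ) : ℝ :=
  2 * x + 6 / 5 * hinge (1 / 2) x + 8 / 5 * hinge (3 / 4) x + 8 / 5 * hinge 1 x
    + 32 / 5 * hinge (11 / 8) x

/-- The value of the place that goes with `wNear`. -/
noncomputable def vNear (x : ℝ) : ℝ :=
  2 / 5 * x - 2 / 5 * hinge (1 / 2) x + 8 / 5 * hinge (3 / 4) x - 8 / 5 * hinge 1 x
    + 32 / 5 * hinge (11 / 8) x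

/-- The near weight that is used once a dawn was spent in the zone. -/
noncomputable def wZone (x : ℝ) : ℝ :=
  2 * x + 6 / 5 * hinge (1 / 2) x + 8 / 5 * hinge (3 / 4) x + 8 / 5 * hinge 1 x
    + 32 / 5 * hinge (40 / 29) x

/-- The value of the place that goes with `wZone` up to the first dawn in the zone. -/
noncomputable def vZone (x : ℝ) : ℝ :=
  2 / 5 * x - 2 / 5 * hinge (1 / 2) x + 8 / 5 * hinge (3 / 4) x - 8 / 5 * hinge (59 / 58) x
    + 32 / 5 * hinge (40 / 29) x

/-- The value of the place that goes with `wZone` after a dawn in the zone. -/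
noncomputable def vPastZone (x : ℝ) : ℝ := 91 / 145 + 32 / 5 * hinge (11 / 8) x

lemma isWeight_wNear : IsWeight wNear :=
  (((isWeight_two_mul.add_hinge (by norm_num) (by norm_num)).add_hinge (by norm_num)
    (by norm_num)).add_hinge (by norm_num) (by norm_num)).add_hinge (by norm_num) (by norm_num)

lemma isWeight_wZone : IsWeight wZone :=
  (((isWeight_two_mul.add_hinge (by norm_num) (by norm_num)).add_hinge (by norm_num)
    (by norm_num)).add_hinge (by norm_num) (by norm_num)).add_hinge (by norm_num) (by norm_num)

lemma vNear_zero : vNear 0 = 0 := by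
  unfold vNear hinge
  norm_num

lemma vZone_zero : vZone 0 = 0 := by
  unfold vZone hinge
  norm_num

lemma near_cases (x : ℝ) :
    (x ≤ 1 / 2 ∧ wNear x = 2 * x ∧ vNear x = 2 / 5 * x) ∨
    (1 / 2 ≤ x ∧ x ≤ 3 / 4 ∧ wNear x = 16 / 5 * x - 3 / 5 ∧ vNear x = 1 / 5) ∨
    (3 / 4 ≤ x ∧ x ≤ 1 ∧ wNear x = 24 / 5 * x - 9 / 5 ∧ vNear x = 8 / 5 * x - 1) ∨
    (1 ≤ x ∧ x ≤ 11 / 8 ∧ wNear x = 32 / 5 * x - 17 / 5 ∧ vNear x = 3 / 5) ∨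
    (11 / 8 ≤ x ∧ wNear x = 64 / 5 * x - 61 / 5 ∧ vNear x = 32 / 5 * x - 41 / 5) := by
  unfold wNear vNear
  rcases le_total x (1 / 2) with h1 | h1
  · left
    rw [hinge_of_le (by linarith), hinge_of_le (by linarith), hinge_of_le (by linarith),
      hinge_of_le (by linarith)]
    exact ⟨h1, by ring, by ring⟩
  rcases le_total x (3 / 4) with h2 | h2
  · right; left
    rw [hinge_of_ge h1, hinge_of_le h2, hinge_of_le (by linarith), hinge_of_le (by linarith)]
    exact ⟨h1, h2, by ring, by ring⟩
  rcases le_total x 1 with h3 | h3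
  · right; right; left
    rw [hinge_of_ge h1, hinge_of_ge h2, hinge_of_le h3, hinge_of_le (by linarith)]
    exact ⟨h2, h3, by ring, by ring⟩
  rcases le_total x (11 / 8) with h4 | h4
  · right; right; right; left
    rw [hinge_of_ge h1, hinge_of_ge h2, hinge_of_ge h3, hinge_of_le h4]
    exact ⟨h3, h4, by ring, by ring⟩
  · right; right; right; right
    rw [hinge_of_ge h1, hinge_of_ge h2, hinge_of_ge h3, hinge_of_ge h4]
    exact ⟨h4, by ring, by ring⟩

lemma wZone_cases (x : ℝ) :
    (x ≤ 1 / 2 ∧ wZone x = 2 * x) ∨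
    (1 / 2 ≤ x ∧ x ≤ 3 / 4 ∧ wZone x = 16 / 5 * x - 3 / 5) ∨
    (3 / 4 ≤ x ∧ x ≤ 1 ∧ wZone x = 24 / 5 * x - 9 / 5) ∨
    (1 ≤ x ∧ x ≤ 40 / 29 ∧ wZone x = 32 / 5 * x - 17 / 5) ∨
    (40 / 29 ≤ x ∧ wZone x = 64 / 5 * x - 1773 / 145) := by
  unfold wZone
  rcases le_total x (1 / 2) with h1 | h1
  · left
    rw [hinge_of_le (by linarith), hinge_of_le (by linarith), hinge_of_le (by linarith),
      hinge_of_le (by linarith)]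
    exact ⟨h1, by ring⟩
  rcases le_total x (3 / 4) with h2 | h2
  · right; left
    rw [hinge_of_ge h1, hinge_of_le h2, hinge_of_le (by linarith), hinge_of_le (by linarith)]
    exact ⟨h1, h2, by ring⟩
  rcases le_total x 1 with h3 | h3
  · right; right; left
    rw [hinge_of_ge h1, hinge_of_ge h2, hinge_of_le h3, hinge_of_le (by linarith)]
    exact ⟨h2, h3, by ring⟩
  rcases le_total x (40 / 29) with h4 | h4
  · right; right; right; left
    rw [hinge_of_ge h1, hinge_of_ge h2, hinge_of_ge h3, hinge_of_le h4]
    exact ⟨h3, h4, by ring⟩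
  · right; right; right; right
    rw [hinge_of_ge h1, hinge_of_ge h2, hinge_of_ge h3, hinge_of_ge h4]
    exact ⟨h4, by ring⟩

lemma vZone_cases (x : ℝ) :
    (x ≤ 1 / 2 ∧ vZone x = 2 / 5 * x) ∨
    (1 / 2 ≤ x ∧ x ≤ 3 / 4 ∧ vZone x = 1 / 5) ∨
    (3 / 4 ≤ x ∧ x ≤ 59 / 58 ∧ vZone x = 8 / 5 * x - 1) ∨
    (59 / 58 ≤ x ∧ x ≤ 40 / 29 ∧ vZone x = 91 / 145) ∨
    (40 / 29 ≤ x ∧ vZone x = 32 / 5 * x - 41 / 5) := by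
  unfold vZone
  rcases le_total x (1 / 2) with h1 | h1
  · left
    rw [hinge_of_le (by linarith), hinge_of_le (by linarith), hinge_of_le (by linarith),
      hinge_of_le (by linarith)]
    exact ⟨h1, by ring⟩
  rcases le_total x (3 / 4) with h2 | h2
  · right; left
    rw [hinge_of_ge h1, hinge_of_le h2, hinge_of_le (by linarith), hinge_of_le (by linarith)]
    exact ⟨h1, h2, by ring⟩
  rcases le_total x (59 / 58) with h3 | h3
  · right; right; left
    rw [hinge_of_ge h1, hinge_of_ge h2, hinge_of_le h3, hinge_of_le (by linarith)]
    exact ⟨h2, h3, by ring⟩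
  rcases le_total x (40 / 29) with h4 | h4
  · right; right; right; left
    rw [hinge_of_ge h1, hinge_of_ge h2, hinge_of_ge h3, hinge_of_le h4]
    exact ⟨h3, h4, by ring⟩
  · right; right; right; right
    rw [hinge_of_ge h1, hinge_of_ge h2, hinge_of_ge h3, hinge_of_ge h4]
    exact ⟨h4, by ring⟩

lemma vPastZone_cases (x : ℝ) : (x ≤ 11 / 8 ∧ vPastZone x = 91 / 145) ∨
    (11 / 8 ≤ x ∧ vPastZone x = 32 / 5 * x - 237 / 29) := by
  unfold vPastZone
  rcases le_total x (11 / 8) with h | h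
  · exact .inl ⟨h, by rw [hinge_of_le h]; ring⟩
  · exact .inr ⟨h, by rw [hinge_of_ge h]; ring⟩

lemma dayCondition_near (p q : ℝ) (hp : 0 ≤ p) (hq : 0 ≤ q) (hp' : p ≤ 21 / 20 ∨ 11 / 8 ≤ p)
    (hq' : q ≤ 21 / 20 ∨ 11 / 8 ≤ q) : DayCondition wNear vNear vNear p q := by
  have f : 0 ≤ wNear p + vNear p - p ∧ 0 ≤ wNear p + vNear p - 8 / 5 * p ∧
      0 ≤ wNear p + vNear p - 12 / 5 * p ∧ -2 / 5 ≤ wNear p + vNear p - 16 / 5 * p ∧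
      -14 / 5 ≤ wNear p + vNear p - 32 / 5 * p := by
    rcases near_cases p with ⟨_, e, e'⟩ | ⟨_, _, e, e'⟩ | ⟨_, _, e, e'⟩ | ⟨_, _, e, e'⟩ |
      ⟨_, e, e'⟩ <;>
    rw [e, e'] <;> refine ⟨?_, ?_, ?_, ?_, ?_⟩ <;> rcases hp' with hp' | hp' <;> linarith
  have g : 0 ≤ wNear q - vNear q - q ∧ 0 ≤ wNear q - vNear q - 8 / 5 * q ∧
      -2 / 5 ≤ wNear q - vNear q - 12 / 5 * q ∧ -4 / 5 ≤ wNear q - vNear q - 16 / 5 * q ∧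
      -4 ≤ wNear q - vNear q - 32 / 5 * q := by
    rcases near_cases q with ⟨_, e, e'⟩ | ⟨_, _, e, e'⟩ | ⟨_, _, e, e'⟩ | ⟨_, _, e, e'⟩ |
      ⟨_, e, e'⟩ <;>
    rw [e, e'] <;> refine ⟨?_, ?_, ?_, ?_, ?_⟩ <;> rcases hq' with hq' | hq' <;> linarith
  obtain ⟨f1, f2, f3, f4, f5⟩ := f
  obtain ⟨g1, g2, g3, g4, g5⟩ := g
  unfold DayCondition
  rcases near_cases ((1 + p + q) / 2) with ⟨_, e, _⟩ | ⟨_, _, e, _⟩ | ⟨_, _, e, _⟩ |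
    ⟨_, _, e, _⟩ | ⟨_, e, _⟩ <;>
  rw [e] <;> linarith

/-- The end at `p` of the day condition, for each piece of `wZone` at the turning point. -/
lemma zone_dawn (p : ℝ) (hp : 0 ≤ p) :
    0 ≤ wZone p + vZone p - p ∧ 0 ≤ wZone p + vZone p - 8 / 5 * p ∧
    0 ≤ wZone p + vZone p - 12 / 5 * p ∧ -2 / 5 ≤ wZone p + vZone p - 16 / 5 * p ∧
    -14 / 5 ≤ wZone p + vZone p - 32 / 5 * p := by
  rcases wZone_cases p with ⟨_, e⟩ | ⟨_, _, e⟩ | ⟨_, _, e⟩ | ⟨_, _, e⟩ | ⟨_, e⟩ <;>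
  rcases vZone_cases p with ⟨_, e'⟩ | ⟨_, _, e'⟩ | ⟨_, _, e'⟩ | ⟨_, _, e'⟩ | ⟨_, e'⟩ <;>
  first
  | (exfalso; linarith)
  | (rw [e, e']; refine ⟨?_, ?_, ?_, ?_, ?_⟩ <;> linarith)

/-- The end at `q` of the day condition, for each piece of `wZone` at the turning point. -/
lemma zone_dusk (q : ℝ) (hq : 0 ≤ q) :
    0 ≤ wZone q - vZone q - q ∧ 0 ≤ wZone q - vZone q - 8 / 5 * q ∧
    -2 / 5 ≤ wZone q - vZone q - 12 / 5 * q ∧ -4 / 5 ≤ wZone q - vZone q - 16 / 5 * q ∧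
    -584 / 145 ≤ wZone q - vZone q - 32 / 5 * q := by
  rcases wZone_cases q with ⟨_, e⟩ | ⟨_, _, e⟩ | ⟨_, _, e⟩ | ⟨_, _, e⟩ | ⟨_, e⟩ <;>
  rcases vZone_cases q with ⟨_, e'⟩ | ⟨_, _, e'⟩ | ⟨_, _, e'⟩ | ⟨_, _, e'⟩ | ⟨_, e'⟩ <;>
  first
  | (exfalso; linarith)
  | (rw [e, e']; refine ⟨?_, ?_, ?_, ?_, ?_⟩ <;> linarith)

lemma dayCondition_zone (p q : ℝ) (hp : 0 ≤ p) (hq : 0 ≤ q) :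
    DayCondition wZone vZone vZone p q := by
  obtain ⟨f1, f2, f3, f4, f5⟩ := zone_dawn p hp
  obtain ⟨g1, g2, g3, g4, g5⟩ := zone_dusk q hq
  unfold DayCondition
  rcases wZone_cases ((1 + p + q) / 2) with ⟨_, e⟩ | ⟨_, _, e⟩ | ⟨_, _, e⟩ | ⟨_, _, e⟩ |
    ⟨_, e⟩ <;>
  rw [e] <;> linarith

lemma dayCondition_pastZone (p q : ℝ) (hp : 0 ≤ p) (hq : 0 ≤ q) :
    DayCondition wZone vPastZone vPastZone p q := by
  have f : 91 / 145 ≤ wZone p + vPastZone p - p ∧ 91 / 145 ≤ wZone p + vPastZone p - 8 / 5 * p ∧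
      62 / 145 ≤ wZone p + vPastZone p - 12 / 5 * p ∧
      4 / 145 ≤ wZone p + vPastZone p - 16 / 5 * p ∧
      -402 / 145 ≤ wZone p + vPastZone p - 32 / 5 * p := by
    rcases wZone_cases p with ⟨_, e⟩ | ⟨_, _, e⟩ | ⟨_, _, e⟩ | ⟨_, _, e⟩ | ⟨_, e⟩ <;>
    rcases vPastZone_cases p with ⟨_, e'⟩ | ⟨_, e'⟩ <;>
    first
    | (exfalso; linarith)
    | (rw [e, e']; refine ⟨?_, ?_, ?_, ?_, ?_⟩ <;> linarith)
  have g : -91 / 145 ≤ wZone q - vPastZone q - q ∧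
      -91 / 145 ≤ wZone q - vPastZone q - 8 / 5 * q ∧
      -120 / 145 ≤ wZone q - vPastZone q - 12 / 5 * q ∧
      -178 / 145 ≤ wZone q - vPastZone q - 16 / 5 * q ∧
      -588 / 145 ≤ wZone q - vPastZone q - 32 / 5 * q := by
    rcases wZone_cases q with ⟨_, e⟩ | ⟨_, _, e⟩ | ⟨_, _, e⟩ | ⟨_, _, e⟩ | ⟨_, e⟩ <;>
    rcases vPastZone_cases q with ⟨_, e'⟩ | ⟨_, e'⟩ <;>
    first
    | (exfalso; linarith)
    | (rw [e, e']; refine ⟨?_, ?_, ?_, ?_, ?_⟩ <;> linarith)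
  obtain ⟨f1, f2, f3, f4, f5⟩ := f
  obtain ⟨g1, g2, g3, g4, g5⟩ := g
  unfold DayCondition
  rcases wZone_cases ((1 + p + q) / 2) with ⟨_, e⟩ | ⟨_, _, e⟩ | ⟨_, _, e⟩ | ⟨_, _, e⟩ |
    ⟨_, e⟩ <;>
  rw [e] <;> linarith

/-- The day condition for `wNear` may fail only for days that start or end in the zone. The one for
`wZone` never fails, and at a dawn in the zone the values `vZone` and `vPastZone` of the place
agree, so that the latter, which is nowhere smaller, can be used from then on. -/
theorem Side.near_potential {p A x a : ℝ} {B M : Multiset ℝ} {c : Bool}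
    (h : Side p B A x c M a) :
    tot wNear B + vNear p ≤ A ∨ tot wZone B + vPastZone p ≤ A := by
  have key := h.dawn_induction (P := fun p B A => tot wZone B + vZone p ≤ A ∧
    (((p ≤ 21 / 20 ∨ 11 / 8 ≤ p) ∧ tot wNear B + vNear p ≤ A) ∨
      tot wZone B + vPastZone p ≤ A)) (by simp [vNear_zero, vZone_zero]; norm_num) ?_
  · exact key.2.imp And.right id
  rintro p B A q B' a hp ⟨h1, h2⟩ hday
  have h3 : tot wZone B' + vZone q ≤ A + a := by
    simpa using hday.gain isWeight_wZone (dayCondition_zone p q hp hday.nonneg) (R := 0)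
      (by simpa using h1)
  refine ⟨h3, ?_⟩
  rcases h2 with ⟨hpz, h2⟩ | h2
  · by_cases hqz : q ≤ 21 / 20 ∨ 11 / 8 ≤ q
    · left
      refine ⟨hqz, ?_⟩
      simpa using hday.gain isWeight_wNear (dayCondition_near p q hp hday.nonneg hpz hqz) (R := 0)
        (by simpa using h2)
    · right
      push Not at hqz
      have e1 : vZone q = vPastZone q := by
        rcases vZone_cases q with ⟨_, e⟩ | ⟨_, _, e⟩ | ⟨_, _, e⟩ | ⟨_, _, e⟩ | ⟨_, e⟩ <;>
        rcases vPastZone_cases q with ⟨_, e'⟩ | ⟨_, e'⟩ <;>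
        first
        | (exfalso; linarith)
        | (rw [e, e'])
      linarith
  · right
    simpa using hday.gain isWeight_wZone (dayCondition_pastZone p q hp hday.nonneg) (R := 0)
      (by simpa using h2)

/-- The length walked before a dawn beyond `X`, if a box lies beyond `X` or is carried there on a
walk that does not lead back below `X`. The two alternatives for the potential give the same
bound. -/
theorem Side.near_le {p A x a : ℝ} {B M : Multiset ℝ} {c : Bool} (h : Side p B A x c M a)
    {X b : ℝ} (hX : 40 / 29 ≤ X) (hp : X ≤ p) (ha : a ≤ x - X) (hb : b ∈ M + load c x)
    (hXb : X ≤ b) : 96 / 5 * X - 102 / 5 ≤ A := by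
  have key : ∀ W, IsWeight W → W X ≤ tot W B := by
    intro W hW
    rcases h.truncated hW (θ := X) (by linarith) with h1 | h1
    · obtain ⟨N, hN⟩ := Multiset.exists_cons_of_mem hb
      have h2 : 0 ≤ tot (fun y => W (min y X)) N := tot_nonneg fun y hy =>
        hW.nonneg (le_min (h.load_nonneg y (by simp [hN, hy])) (by linarith))
      rw [hN, tot_cons, min_eq_right hXb] at h1
      linarith
    · linarith
  rcases h.near_potential with h1 | h1
  · have h2 := key _ isWeight_wNear
    rcases near_cases p with ⟨_, _, e⟩ | ⟨_, _, _, e⟩ | ⟨_, _, _, e⟩ | ⟨_, _, _, e⟩ | ⟨_, _, e⟩ <;>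
    rcases near_cases X with ⟨_, e', _⟩ | ⟨_, _, e', _⟩ | ⟨_, _, e', _⟩ | ⟨_, _, e', _⟩ |
      ⟨_, e', _⟩ <;>
    first
    | (exfalso; linarith)
    | (rw [e] at h1; rw [e'] at h2; linarith)
  · have h2 := key _ isWeight_wZone
    rcases vPastZone_cases p with ⟨_, e⟩ | ⟨_, e⟩ <;>
    rcases wZone_cases X with ⟨_, e'⟩ | ⟨_, _, e'⟩ | ⟨_, _, e'⟩ | ⟨_, _, e'⟩ | ⟨_, e'⟩ <;>
    first
    | (exfalso; linarith)
    | (rw [e] at h1; rw [e'] at h2; linarith)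

/-! ### Lifting a plan to the line -/

/-- The point of the circuit that is reached from the base by walking the length `u`, measured
in days' walks. -/
noncomputable def point (u : ℝ) : Circuit := ((20 * u : ℝ) : Circuit)

/-- A state of an expedition lifted to the line: `N` full days are over, `w` has been walked since
the last dawn, the place is `point u`, `c` tells whether a box is carried, `M` are the places of
the other boxes, and the places visited so far are the ones over the interval from `lo` to `hi`.
The unit of length is a day's walk. -/
structure Config where
  N : ℕ
  w : ℝ
  u : ℝ
  c : Bool
  M : Multiset Circuit
  lo : ℝ
  hi : ℝ

/-- The moves, and the dawns at which a box is unsealed, in terms of lifted states. -/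
inductive Go : Config → Config → Prop
  | walk {N w u c M lo hi} (d : ℝ) (h : w + |d| ≤ 1) :
      Go ⟨N, w, u, c, M, lo, hi⟩ ⟨N, w + |d|, u + d, c, M, min lo (u + d), max hi (u + d)⟩
  | pick {N w u M lo hi} : Go ⟨N, w, u, false, point u ::ₘ M, lo, hi⟩ ⟨N, w, u, true, M, lo, hi⟩
  | pickBase {N w u M lo hi} (h : point u = 0) :
      Go ⟨N, w, u, false, M, lo, hi⟩ ⟨N, w, u, true, M, lo, hi⟩
  | dump {N w u M lo hi} : Go ⟨N, w, u, true, M, lo, hi⟩ ⟨N, w, u, false, point u ::ₘ M, lo, hi⟩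
  | carried {N w u M lo hi} : Go ⟨N, w, u, true, M, lo, hi⟩ ⟨N + 1, 0, u, false, M, lo, hi⟩
  | lying {N w u c M lo hi} : Go ⟨N, w, u, c, point u ::ₘ M, lo, hi⟩ ⟨N + 1, 0, u, c, M, lo, hi⟩
  | base {N w u c M lo hi} (h : point u = 0) :
      Go ⟨N, w, u, c, M, lo, hi⟩ ⟨N + 1, 0, u, c, M, lo, hi⟩

/-- The lifted state after the first box has been unsealed. -/
def origin : Config := ⟨0, 0, 0, false, 0, 0, 0⟩

/-- The lifted state `κ` describes the state `s`. -/
structure Lifts (κ : Config) (s : State) : Prop where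
  place : s.place = point κ.u
  carrying : s.carrying = κ.c
  dumps : s.dumps = κ.M
  seen : s.seen ⊆ point '' Set.Icc κ.lo κ.hi
  lo_le : κ.lo ≤ κ.u
  le_hi : κ.u ≤ κ.hi

lemma point_add_coe (u d : ℝ) : point u + (d : Circuit) = point (u + d / 20) := by
  unfold point
  rw [← AddCircle.coe_add]
  congr 1
  ring

lemma point_zero : point 0 = 0 := by simp [point]

lemma stretch_subset (u d : ℝ) :
    stretch (point u) d ⊆ point '' Set.Icc (min u (u + d / 20)) (max u (u + d / 20)) := by
  rintro _ ⟨x, hx, rfl⟩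
  refine ⟨u + x / 20, ?_, (point_add_coe u x).symm⟩
  rcases Set.mem_uIcc.mp hx with ⟨h1, h2⟩ | ⟨h1, h2⟩
  · exact ⟨(min_le_left _ _).trans (by linarith), le_max_of_le_right (by linarith)⟩
  · exact ⟨(min_le_right _ _).trans (by linarith), le_max_of_le_left (by linarith)⟩

lemma lift_step {s t : State} {m : Move} (h : Step s m t) {κ : Config} (hκ : Lifts κ s)
    (hm : κ.w + m.miles / 20 ≤ 1) :
    ∃ κ', Go κ κ' ∧ Lifts κ' t ∧ κ'.N = κ.N ∧ κ'.w = κ.w + m.miles / 20 := by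
  obtain ⟨N, w, u, c, M, lo, hi⟩ := κ
  cases h with
  | walk d =>
    obtain ⟨h1, h2, h3, h4, h5, h6⟩ := hκ
    simp only [Move.miles] at *
    have e : |d / 20| = |d| / 20 := by rw [abs_div, abs_of_pos (by norm_num : (0 : ℝ) < 20)]
    refine ⟨_, Go.walk (d / 20) (by rw [e]; exact hm), ⟨?_, h2, h3, ?_, ?_, ?_⟩, rfl, by rw [e]⟩
    · simp only [h1, point_add_coe]
    · refine Set.union_subset (h4.trans (Set.image_mono ?_)) ?_
      · exact Set.Icc_subset_Icc (min_le_left _ _) (le_max_left _ _)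
      · rw [h1]
        refine (stretch_subset u d).trans (Set.image_mono ?_)
        exact Set.Icc_subset_Icc (min_le_min_right _ h5) (max_le_max_right _ h6)
    · exact min_le_right _ _
    · exact le_max_right _ _
  | pickUp D free ht =>
    obtain ⟨h1, h2, h3, h4, h5, h6⟩ := hκ
    simp only [Move.miles] at *
    cases ht with
    | base c' =>
      simp only at free h2 h1 h3
      subst free h3 h2
      exact ⟨_, Go.pickBase h1.symm, ⟨h1, rfl, rfl, h4, h5, h6⟩, rfl, by simp⟩
    | dumped p =>
      simp only at free h2 h1 h3
      subst free h3 h2 h1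
      exact ⟨_, Go.pick, ⟨rfl, rfl, rfl, h4, h5, h6⟩, rfl, by simp⟩
  | dump hc =>
    obtain ⟨h1, h2, h3, h4, h5, h6⟩ := hκ
    simp only [Move.miles] at *
    rw [hc] at h2
    subst h2
    exact ⟨_, Go.dump, ⟨h1, rfl, by simp only [h1, h3], h4, h5, h6⟩, rfl, by simp⟩

lemma miles_nonneg (day : List Move) : 0 ≤ miles day := by
  apply List.sum_nonneg
  intro x hx
  obtain ⟨m, _, rfl⟩ := List.mem_map.mp hx
  cases m <;> simp [Move.miles]

lemma lift_steps {s t : State} {day : List Move} (h : Steps s day t) :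
    ∀ {κ : Config}, Lifts κ s → κ.w + miles day / 20 ≤ 1 →
    ∃ κ', Relation.ReflTransGen Go κ κ' ∧ Lifts κ' t ∧ κ'.N = κ.N ∧
      κ'.w = κ.w + miles day / 20 := by
  induction h with
  | nil s =>
    intro κ hκ _
    exact ⟨κ, .refl, hκ, rfl, by simp [miles]⟩
  | cons h h' ih =>
    rename_i s t u m l
    intro κ hκ hm
    have e : miles (m :: l) = m.miles + miles l := by simp [miles]
    rw [e] at hm ⊢
    have := miles_nonneg l
    obtain ⟨κ₁, g1, l1, n1, w1⟩ := lift_step h hκ (by linarith)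
    obtain ⟨κ₂, g2, l2, n2, w2⟩ := ih l1 (by rw [w1]; linarith)
    exact ⟨κ₂, g2.head g1, l2, n2.trans n1, by rw [w2, w1]; ring⟩

lemma lift_unseal {s t : State} (h : Unseal s t) {κ : Config} (hκ : Lifts κ s) :
    ∃ κ', Go κ κ' ∧ Lifts κ' t ∧ κ'.N = κ.N + 1 ∧ κ'.w = 0 := by
  obtain ⟨N, w, u, c, M, lo, hi⟩ := κ
  obtain ⟨h1, h2, h3, h4, h5, h6⟩ := hκ
  simp only at *
  cases h with
  | carried hc =>
    rw [hc] at h2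
    subst h2
    exact ⟨_, Go.carried, ⟨h1, rfl, h3, h4, h5, h6⟩, rfl, rfl⟩
  | lying D ht =>
    cases ht with
    | base c' =>
      simp only at h1 h2 h3
      subst h3 h2
      exact ⟨_, Go.base h1.symm, ⟨h1, rfl, rfl, h4, h5, h6⟩, rfl, rfl⟩
    | dumped p =>
      simp only at h1 h2 h3
      subst h3 h2 h1
      exact ⟨_, Go.lying, ⟨rfl, rfl, rfl, h4, h5, h6⟩, rfl, rfl⟩

lemma lift_run : ∀ {plan : List (List Move)} {day : List Move} {s u t : State} {κ : Config},
    Steps s day u → miles day ≤ 20 → Run u plan t → Lifts κ s → κ.w = 0 →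
    ∃ κ', Relation.ReflTransGen Go κ κ' ∧ Lifts κ' t ∧
      κ'.N + κ'.w = κ.N + duration (day :: plan)
  | [], day, s, u, t, κ => by
    intro h1 h2 h3 h4 h5
    cases h3
    obtain ⟨κ', g, l, n, w⟩ := lift_steps h1 h4 (by rw [h5]; linarith)
    exact ⟨κ', g, l, by rw [n, w, h5, duration]; ring⟩
  | day' :: plan, day, s, u, t, κ => by
    intro h1 h2 h3 h4 h5
    obtain ⟨κ₁, g1, l1, n1, w1⟩ := lift_steps h1 h4 (by rw [h5]; linarith)
    cases h3 with
    | cons h h' =>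
      obtain ⟨u', hu, hs, hm⟩ := h
      obtain ⟨κ₂, g2, l2, n2, w2⟩ := lift_unseal hu l1
      obtain ⟨κ₃, g3, l3, n3⟩ := lift_run hs hm h' l2 w2
      refine ⟨κ₃, (g1.tail g2).trans g3, l3, ?_⟩
      rw [n3, n2, n1, duration]
      push_cast
      ring

lemma five_le_of_univ {lo hi : ℝ} (h : (Set.univ : Set Circuit) ⊆ point '' Set.Icc lo hi) :
    5 ≤ hi - lo := by
  by_contra hlt
  push Not at hlt
  -- The middle of the gap between the interval and its translate by a period is missed.
  obtain ⟨z, ⟨hz1, hz2⟩, hz⟩ := h (Set.mem_univ (point ((lo + hi + 5) / 2)))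
  unfold point at hz
  obtain ⟨n, hn⟩ := (AddCircle.coe_eq_zero_iff (100 : ℝ)).mp
    (show (((20 * ((lo + hi + 5) / 2) - 20 * z : ℝ)) : Circuit) = 0 by
      rw [AddCircle.coe_sub, ← hz, sub_self])
  rw [zsmul_eq_mul] at hn
  have h1 : (0 : ℝ) < n := by linarith
  have h2 : (n : ℝ) < 1 := by linarith
  norm_cast at h1 h2
  omega

lemma point_eq_zero_iff {u : ℝ} : point u = 0 ↔ ∃ n : ℤ, u = 5 * n := by
  unfold point
  rw [AddCircle.coe_eq_zero_iff]
  constructor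
  · rintro ⟨n, hn⟩
    rw [zsmul_eq_mul] at hn
    exact ⟨n, by linarith⟩
  · rintro ⟨n, rfl⟩
    exact ⟨n, by rw [zsmul_eq_mul]; ring⟩

/-- A plan that completes the circuit lifts to a walk on the line that covers a whole period. -/
theorem lift_plan {plan : List (List Move)} (h : CompletesCircuit plan) :
    ∃ κ, Relation.ReflTransGen Go origin κ ∧ (κ.N + κ.w : ℝ) = duration plan ∧
      point κ.u = 0 ∧ 5 ≤ κ.hi - κ.lo := by
  obtain ⟨t, ht, hp, hs⟩ := h
  cases ht with
  | nil =>
    exfalso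
    have h1 : (Set.univ : Set Circuit) ⊆ point '' Set.Icc 0 0 := by
      rw [← hs]
      simp [start, point_zero]
    have := five_le_of_univ h1
    norm_num at this
  | cons h h' =>
    obtain ⟨s', hu, hs', hm⟩ := h
    have e : s' = start := by
      cases hu with
      | carried hc => simp [start] at hc
      | lying D ht =>
        generalize hst : start = s₀ at ht
        cases ht with
        | base c D S => rw [← hst]
        | dumped p c D S => simp [start] at hst
    subst e
    have hl : Lifts origin start :=
      ⟨by simp [start, origin, point_zero], rfl, rfl, by simp [start, origin, point_zero], le_rfl,
        le_rfl⟩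
    obtain ⟨κ, g, l, n⟩ := lift_run hs' hm h' hl rfl
    refine ⟨κ, g, by simpa [origin] using n, by rw [← l.place, hp], ?_⟩
    exact five_le_of_univ (hs ▸ l.seen)

/-! ### The two sides of the base -/

instance : Fact ((0 : ℝ) < 100) := ⟨by norm_num⟩

/-- The distance of a point from the base in the direction of increasing mile points, from `0`
(exclusive) to `5` (inclusive) days' walks. -/
noncomputable def ahead (P : Circuit) : ℝ := (AddCircle.equivIoc 100 0 P : ℝ) / 20

/-- The distance from the base for points of the near half of the circuit; `0` for others. -/
noncomputable def nearDist (P : Circuit) : ℝ := if ahead P ≤ 5 / 2 then ahead P else 0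

/-- The distance from the base for points of the far half of the circuit; `0` for others. -/
noncomputable def farDist (P : Circuit) : ℝ := if ahead P ≤ 5 / 2 then 0 else 5 - ahead P

lemma ahead_point {u : ℝ} (h0 : 0 < u) (h5 : u ≤ 5) : ahead (point u) = u := by
  unfold ahead point
  rw [AddCircle.equivIoc_coe_of_mem]
  · ring
  · constructor <;> linarith

lemma point_add_five (u : ℝ) : point (u + 5) = point u := by
  unfold point
  rw [← AddCircle.coe_add_period (100 : ℝ) (20 * u)]
  congr 1
  ring

lemma eq_zero_of_point {u : ℝ} (h : point u = 0) (h0 : -5 < u) (h1 : u < 5) : u = 0 := by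
  obtain ⟨n, rfl⟩ := point_eq_zero_iff.mp h
  have a1 : (n : ℝ) < 1 := by linarith
  have a2 : (-1 : ℝ) < n := by linarith
  norm_cast at a1 a2
  have : n = 0 := by omega
  simp [this]

lemma nearDist_point {u : ℝ} (h0 : -(5 / 2) < u) (h1 : u ≤ 5 / 2) :
    nearDist (point u) = max u 0 := by
  unfold nearDist
  rcases lt_or_ge 0 u with h | h
  · rw [ahead_point h (by linarith), if_pos h1, max_eq_left h.le]
  · rw [← point_add_five, ahead_point (by linarith) (by linarith), if_neg (by linarith),
      max_eq_right h]

lemma farDist_point {u : ℝ} (h0 : -(5 / 2) < u) (h1 : u ≤ 5 / 2) :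
    farDist (point u) = max (-u) 0 := by
  unfold farDist
  rcases lt_or_ge 0 u with h | h
  · rw [ahead_point h (by linarith), if_pos h1, max_eq_right (by linarith)]
  · rw [← point_add_five, ahead_point (by linarith) (by linarith), if_neg (by linarith),
      max_eq_left (by linarith)]
    ring

/-- Up to the arrival at the point opposite to the base, an expedition splits into what happens on
the near side and what happens on the far side. -/
def Splits (κ : Config) : Prop :=
  -(5 / 2) < κ.u ∧ κ.u ≤ 5 / 2 ∧ κ.w ≤ 1 ∧ κ.lo ≤ 0 ∧ κ.lo ≤ κ.u ∧ κ.hi ≤ 5 / 2 ∧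
    ∃ pn Bn An an pf Bf Af af,
      Side pn Bn An (max κ.u 0) κ.c (κ.M.map nearDist) an ∧
      Side pf Bf Af (max (-κ.u) 0) κ.c (κ.M.map farDist) af ∧
      an + af ≤ κ.w ∧ An + Af ≤ κ.N ∧ (pn = 0 ∨ pf = 0) ∧
      (af = 0 ∨ pn + max κ.u 0 ≤ an) ∧
      (2 * (-κ.lo) ≤ af + pf + max (-κ.u) 0 ∨ vBoth (-κ.lo - 1 / 2) ≤ Af)

lemma Side.vBoth_le {p A x a : ℝ} {B M : Multiset ℝ} {c : Bool} (h : Side p B A x c M a)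
    (hB : ∀ b ∈ B, 0 ≤ b) : vBoth p ≤ A := by
  have h1 := h.wBoth_le
  have h2 : 0 ≤ tot wBoth B := tot_nonneg fun b hb => isWeight_wBoth.nonneg (hB b hb)
  linarith

lemma Side.dawn_boxes_nonneg {p A x a : ℝ} {B M : Multiset ℝ} {c : Bool}
    (h : Side p B A x c M a) : ∀ b ∈ B, 0 ≤ b :=
  h.dawn_induction (P := fun _ B _ => ∀ b ∈ B, 0 ≤ b) (by simp)
    fun _ _ _ _ _ _ _ _ hday => hday.boxes

lemma splits_origin : Splits origin := by
  refine ⟨by norm_num [origin], by norm_num [origin], by norm_num [origin], le_rfl, le_rfl,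
    by norm_num [origin], 0, 0, 0, 0, 0, 0, 0, 0, ?_, ?_, ?_⟩
  · simpa [origin] using Side.start
  · simpa [origin] using Side.start
  · simp [origin]

/-- What remains of a split at the next dawn, given what remains on either side. -/
lemma splits_dawn {N : ℕ} {w u : ℝ} {c c' : Bool} {M M' : Multiset Circuit} {lo hi : ℝ}
    (h : Splits ⟨N, w, u, c, M, lo, hi⟩)
    (hn : ∀ {p B A a}, Side p B A (max u 0) c (M.map nearDist) a →
      ∃ B', Side (max u 0) B' (A + a) (max u 0) c' (M'.map nearDist) 0)
    (hf : ∀ {p B A a}, Side p B A (max (-u) 0) c (M.map farDist) a →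
      ∃ B', Side (max (-u) 0) B' (A + a) (max (-u) 0) c' (M'.map farDist) 0) :
    Splits ⟨N + 1, 0, u, c', M', lo, hi⟩ := by
  obtain ⟨h1, h2, h3, h4, h5, h6, pn, Bn, An, an, pf, Bf, Af, af, sn, sf, h7, h8, h9, h10, h11⟩ := h
  simp only at *
  obtain ⟨Bn', sn'⟩ := hn sn
  obtain ⟨Bf', sf'⟩ := hf sf
  refine ⟨h1, h2, zero_le_one, h4, h5, h6, _, _, _, _, _, _, _, _, sn', sf', by simp,
    by push_cast; linarith, ?_, .inl rfl, .inr ?_⟩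
  · rcases le_total u 0 with hu | hu
    · exact .inl (max_eq_right hu)
    · exact .inr (max_eq_right (by linarith))
  · have e1 := sf.vBoth_le sf.dawn_boxes_nonneg
    have e2 := sf'.vBoth_le sf'.dawn_boxes_nonneg
    have e3 := sf.nonneg
    have e4 := sf.le_one
    rcases h11 with h11 | h11
    · rcases le_total (-lo - 1 / 2) pf with e | e
      · have := vBoth_mono e
        linarith
      · have := vBoth_mono (x := -lo - 1 / 2) (y := max (-u) 0) (by linarith)
        linarith
    · linarith

lemma splits_walk {N : ℕ} {w u : ℝ} {c : Bool} {M : Multiset Circuit} {lo hi d : ℝ}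
    (h : Splits ⟨N, w, u, c, M, lo, hi⟩) (hd : w + |d| ≤ 1) (hu : -(5 / 2) < u + d)
    (hu' : u + d ≤ 5 / 2) :
    Splits ⟨N, w + |d|, u + d, c, M, min lo (u + d), max hi (u + d)⟩ := by
  obtain ⟨h1, h2, h3, h4, h5, h6, pn, Bn, An, an, pf, Bf, Af, af, sn, sf, h7, h8, h9, h10, h11⟩ := h
  simp only at *
  have key : |max (u + d) 0 - max u 0| + |max (-(u + d)) 0 - max (-u) 0| = |d| := by
    rcases le_total 0 u with a1 | a1 <;> rcases le_total 0 (u + d) with a2 | a2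
    · rw [max_eq_left a2, max_eq_left a1, max_eq_right (by linarith), max_eq_right (by linarith)]
      simp
    · rw [max_eq_right a2, max_eq_left a1, max_eq_left (by linarith), max_eq_right (by linarith),
        abs_of_nonpos (by linarith), abs_of_nonneg (by linarith), abs_of_nonpos (by linarith)]
      ring
    · rw [max_eq_left a2, max_eq_right a1, max_eq_right (by linarith), max_eq_left (by linarith),
        abs_of_nonneg (by linarith), abs_of_nonpos (by linarith), abs_of_nonneg (by linarith)]
      ring
    · rw [max_eq_right a2, max_eq_right a1, max_eq_left (by linarith), max_eq_left (by linarith)]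
      simp only [sub_self, abs_zero, zero_add]
      rw [← abs_neg]
      congr 1
      ring
  have k1 := abs_nonneg (max (u + d) 0 - max u 0)
  have k2 := abs_nonneg (max (-(u + d)) 0 - max (-u) 0)
  have sn' := sn.walk (max (u + d) 0) (le_max_right _ _) (by linarith [sf.nonneg])
  have sf' := sf.walk (max (-(u + d)) 0) (le_max_right _ _) (by linarith [sn.nonneg])
  refine ⟨hu, hu', hd, (min_le_left _ _).trans h4, min_le_right _ _, max_le h6 hu', _, _, _, _,
    _, _, _, _, sn', sf', by linarith, h8, h9, ?_, ?_⟩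
  · have l1 := le_abs_self (max (u + d) 0 - max u 0)
    rcases h10 with rfl | h10
    · have d1 := abs_le.mp sn.dist
      have d2 := abs_le.mp sf.dist
      rcases lt_or_ge u 0 with a1 | a1
      · right
        have e1 : max u 0 = 0 := max_eq_right a1.le
        have e2 : max (-u) 0 = -u := max_eq_left (by linarith)
        have e3 : pn = 0 := by
          rcases h9 with h9 | h9
          · exact h9
          · linarith
        have := sn.nonneg
        linarith
      · rcases lt_or_ge (u + d) 0 with a2 | a2
        · right
          have l2 := neg_le_abs (max (u + d) 0 - max u 0)
          have e1 : max (u + d) 0 = 0 := max_eq_right a2.le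
          linarith
        · left
          rw [max_eq_right (by linarith), max_eq_right (by linarith)]
          simp
    · right
      linarith
  · rcases le_total lo (u + d) with a1 | a1
    · rw [min_eq_left a1]
      refine h11.imp (fun h11 => ?_) id
      have := neg_le_abs (max (-(u + d)) 0 - max (-u) 0)
      linarith
    · rw [min_eq_right a1]
      left
      have := (abs_le.mp sf'.dist).2
      have := le_max_left (-(u + d)) 0
      linarith

lemma Go.splits {κ κ' : Config} (h : Go κ κ') (hκ : Splits κ) (hu : -(5 / 2) < κ'.u)
    (hu' : κ'.u ≤ 5 / 2) : Splits κ' := by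
  have hn := nearDist_point hκ.1 hκ.2.1
  have hf := farDist_point hκ.1 hκ.2.1
  cases h with
  | walk d h => exact splits_walk hκ h hu hu'
  | pick =>
    obtain ⟨h1, h2, h3, h4, h5, h6, pn, Bn, An, an, pf, Bf, Af, af, sn, sf, h⟩ := hκ
    simp only [Multiset.map_cons, hn, hf] at *
    exact ⟨h1, h2, h3, h4, h5, h6, _, _, _, _, _, _, _, _, sn.pick, sf.pick, h⟩
  | pickBase hb =>
    have e := eq_zero_of_point hb (by linarith [hκ.1]) (by linarith [hκ.2.1])
    subst e
    obtain ⟨h1, h2, h3, h4, h5, h6, pn, Bn, An, an, pf, Bf, Af, af, sn, sf, h⟩ := hκ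
    refine ⟨h1, h2, h3, h4, h5, h6, pn, Bn, An, an, pf, Bf, Af, af, ?_, ?_, h⟩
    · norm_num at sn ⊢
      exact sn.pickBase
    · norm_num at sf ⊢
      exact sf.pickBase
  | dump =>
    obtain ⟨h1, h2, h3, h4, h5, h6, pn, Bn, An, an, pf, Bf, Af, af, sn, sf, h⟩ := hκ
    refine ⟨h1, h2, h3, h4, h5, h6, pn, Bn, An, an, pf, Bf, Af, af, ?_, ?_, h⟩
    · simpa [hn] using sn.dump
    · simpa [hf] using sf.dump
  | carried => exact splits_dawn hκ (fun s => ⟨_, s.carried⟩) (fun s => ⟨_, s.carried⟩)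
  | lying =>
    refine splits_dawn hκ (fun s => ?_) (fun s => ?_)
    · rw [Multiset.map_cons, hn] at s
      exact ⟨_, s.lying⟩
    · rw [Multiset.map_cons, hf] at s
      exact ⟨_, s.lying⟩
  | base hb =>
    have e := eq_zero_of_point hb (by linarith [hκ.1]) (by linarith [hκ.2.1])
    subst e
    refine splits_dawn hκ (fun s => ?_) (fun s => ?_) <;> norm_num at s ⊢ <;> exact ⟨_, s.base⟩

/-- The arrival at the point opposite to the base: all the time up to the last dawn is accounted
for by the two sides, and the far side was left before that dawn. -/
theorem Splits.opposite {κ : Config} (h : Splits κ) (hu : κ.u = 5 / 2) :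
    ∃ pn Bn An an Bf Af, Side pn Bn An (5 / 2) κ.c (κ.M.map nearDist) an ∧
      Side 0 Bf Af 0 κ.c (κ.M.map farDist) 0 ∧ an ≤ κ.w ∧ An + Af ≤ κ.N ∧
      vBoth (-κ.lo - 1 / 2) ≤ Af := by
  obtain ⟨-, -, h3, h4, -, -, pn, Bn, An, an, pf, Bf, Af, af, sn, sf, h7, h8, h9, h10, h11⟩ := h
  rw [hu, max_eq_left (by norm_num)] at sn h10
  rw [hu, max_eq_right (by norm_num)] at sf h11
  have h1 := sn.le_one
  have h2 := abs_le.mp sn.dist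
  have h0 := sn.dawn_nonneg
  have e1 : pf = 0 := by
    rcases h9 with h9 | h9
    · linarith
    · exact h9
  have e2 : af = 0 := by
    rcases h10 with h10 | h10
    · exact h10
    · linarith
  subst e1 e2
  refine ⟨_, _, _, _, _, _, sn, sf, by linarith, h8, ?_⟩
  rcases h11 with h11 | h11
  · have e3 : κ.lo = 0 := by linarith
    rw [e3]
    have := vBoth_mono (show (-0 - 1 / 2 : ℝ) ≤ 0 by norm_num)
    rw [vBoth_zero] at this
    linarith [sf.walked_nonneg]
  · exact h11

/-! ### Arriving at the point opposite to the base -/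

/-- The same expedition seen in a mirror through the base. -/
def Config.reflect (κ : Config) : Config :=
  ⟨κ.N, κ.w, -κ.u, κ.c, κ.M.map Neg.neg, -κ.hi, -κ.lo⟩

lemma point_neg (u : ℝ) : point (-u) = -point u := by
  unfold point
  rw [← AddCircle.coe_neg]
  congr 1
  ring

lemma Go.reflect {κ κ' : Config} (h : Go κ κ') : Go κ.reflect κ'.reflect := by
  cases h with
  | walk d h =>
    rename_i N w u c M lo hi
    have := Go.walk (N := N) (w := w) (u := -u) (c := c) (M := M.map Neg.neg) (lo := -hi)
      (hi := -lo) (-d) (by rwa [abs_neg])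
    rw [abs_neg, ← neg_add, min_neg_neg, max_neg_neg] at this
    exact this
  | pick =>
    rename_i N w u M lo hi
    simpa [Config.reflect, point_neg] using
      Go.pick (N := N) (w := w) (u := -u) (M := M.map Neg.neg) (lo := -hi) (hi := -lo)
  | pickBase h => exact Go.pickBase (by rw [point_neg, h, neg_zero])
  | dump =>
    rename_i N w u M lo hi
    simpa [Config.reflect, point_neg] using
      Go.dump (N := N) (w := w) (u := -u) (M := M.map Neg.neg) (lo := -hi) (hi := -lo)
  | carried => exact Go.carried
  | lying =>
    rename_i N w u c M lo hi
    simpa [Config.reflect, point_neg] using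
      Go.lying (N := N) (w := w) (u := -u) (c := c) (M := M.map Neg.neg) (lo := -hi) (hi := -lo)
  | base h => exact Go.base (by rw [point_neg, h, neg_zero])

/-- A walk may be interrupted anywhere on its way. -/
lemma Go.walk_via {N : ℕ} {w u : ℝ} {c : Bool} {M : Multiset Circuit} {lo hi d x : ℝ}
    (h : w + |d| ≤ 1) (hlo : lo ≤ u) (hhi : u ≤ hi)
    (hx : (u ≤ x ∧ x ≤ u + d) ∨ (u + d ≤ x ∧ x ≤ u)) :
    ∃ e : Config, e.u = x ∧ Go ⟨N, w, u, c, M, lo, hi⟩ e ∧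
      Go e ⟨N, w + |d|, u + d, c, M, min lo (u + d), max hi (u + d)⟩ := by
  have ha : |x - u| + |u + d - x| = |d| := by
    rcases hx with ⟨h1, h2⟩ | ⟨h1, h2⟩
    · rw [abs_of_nonneg (by linarith), abs_of_nonneg (by linarith), abs_of_nonneg (by linarith)]
      ring
    · rw [abs_of_nonpos (by linarith), abs_of_nonpos (by linarith), abs_of_nonpos (by linarith)]
      ring
  have g1 := Go.walk (N := N) (w := w) (u := u) (c := c) (M := M) (lo := lo) (hi := hi)
    (x - u) (by linarith [abs_nonneg (u + d - x)])
  have g2 := Go.walk (N := N) (w := w + |x - u|) (u := x) (c := c) (M := M)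
    (lo := min lo x) (hi := max hi x) (u + d - x) (by linarith)
  rw [add_sub_cancel] at g1 g2
  rw [add_assoc, ha] at g2
  have e1 : min (min lo x) (u + d) = min lo (u + d) := by
    rcases hx with ⟨h1, h2⟩ | ⟨h1, h2⟩
    · rw [min_eq_left (by linarith : lo ≤ x)]
    · rw [min_assoc, min_eq_right h1]
  have e2 : max (max hi x) (u + d) = max hi (u + d) := by
    rcases hx with ⟨h1, h2⟩ | ⟨h1, h2⟩
    · rw [max_assoc, max_eq_right h2]
    · rw [max_eq_left (by linarith : x ≤ hi)]
  rw [e1, e2] at g2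
  exact ⟨_, rfl, g1, g2⟩

/-- The opposite point has not been visited, or the expedition was there for a first time. -/
lemma inner_or_opposite {κ : Config} (h : Relation.ReflTransGen Go origin κ) :
    (Splits κ ∧ Splits κ.reflect ∧ -(5 / 2) < κ.lo ∧ κ.hi < 5 / 2) ∨
    ∃ e, ((e.u = 5 / 2 ∧ Splits e) ∨ (e.u = -(5 / 2) ∧ Splits e.reflect)) ∧
      Relation.ReflTransGen Go e κ := by
  induction h with
  | refl =>
    left
    refine ⟨splits_origin, ?_, by norm_num [origin], by norm_num [origin]⟩
    have : origin.reflect = origin := by simp [origin, Config.reflect]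
    rw [this]
    exact splits_origin
  | tail _ hgo ih =>
    rename_i κ κ' _
    rcases ih with ⟨s1, s2, hlo, hhi⟩ | ⟨e, he, hr⟩
    swap
    · exact .inr ⟨e, he, hr.tail hgo⟩
    have hlu : κ.lo ≤ κ.u := s1.2.2.2.2.1
    have huh : κ.u ≤ κ.hi := by
      have := s2.2.2.2.2.1
      simp only [Config.reflect] at this
      linarith
    have stay : -(5 / 2) < κ'.u → κ'.u < 5 / 2 → Splits κ' ∧ Splits κ'.reflect := by
      intro h1 h2
      refine ⟨hgo.splits s1 h1 h2.le, hgo.reflect.splits s2 ?_ ?_⟩ <;>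
      simp only [Config.reflect] <;> linarith
    cases hgo with
    | walk d h =>
      rename_i N w u c M lo hi _
      simp only at *
      rcases lt_or_ge (u + d) (5 / 2) with h1 | h1
      · rcases lt_or_ge (-(5 / 2)) (u + d) with h2 | h2
        · left
          exact ⟨(stay h2 h1).1, (stay h2 h1).2, lt_min hlo h2, max_lt hhi h1⟩
        · right
          obtain ⟨e, he, g1, g2⟩ := Go.walk_via (N := N) (c := c) (M := M) (x := -(5 / 2)) h hlu huh
            (.inr ⟨h2, by linarith⟩)
          refine ⟨e, .inr ⟨he, g1.reflect.splits s2 ?_ ?_⟩, .single g2⟩ <;>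
          simp only [Config.reflect, he] <;> norm_num
      · right
        obtain ⟨e, he, g1, g2⟩ := Go.walk_via (N := N) (c := c) (M := M) (x := 5 / 2) h hlu huh
          (.inl ⟨by linarith, h1⟩)
        exact ⟨e, .inl ⟨he, g1.splits s1 (by rw [he]; norm_num) he.le⟩, .single g2⟩
    | pick =>
      obtain ⟨t1, t2⟩ := stay (by linarith) (by linarith)
      exact .inl ⟨t1, t2, hlo, hhi⟩
    | pickBase =>
      obtain ⟨t1, t2⟩ := stay (by linarith) (by linarith)
      exact .inl ⟨t1, t2, hlo, hhi⟩
    | dump =>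
      obtain ⟨t1, t2⟩ := stay (by linarith) (by linarith)
      exact .inl ⟨t1, t2, hlo, hhi⟩
    | carried =>
      obtain ⟨t1, t2⟩ := stay (by linarith) (by linarith)
      exact .inl ⟨t1, t2, hlo, hhi⟩
    | lying =>
      obtain ⟨t1, t2⟩ := stay (by linarith) (by linarith)
      exact .inl ⟨t1, t2, hlo, hhi⟩
    | base =>
      obtain ⟨t1, t2⟩ := stay (by linarith) (by linarith)
      exact .inl ⟨t1, t2, hlo, hhi⟩

/-- A walk that covers a whole period passes the point opposite to the base; up to reflection it
gets there first on the side of increasing mile points. -/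
theorem exists_opposite {κ : Config} (h : Relation.ReflTransGen Go origin κ)
    (h5 : 5 ≤ κ.hi - κ.lo) :
    ∃ e κ', e.u = 5 / 2 ∧ Splits e ∧ Relation.ReflTransGen Go e κ' ∧ κ'.N = κ.N ∧ κ'.w = κ.w ∧
      (point κ.u = 0 → point κ'.u = 0) ∧ 5 ≤ κ'.hi - κ'.lo := by
  rcases inner_or_opposite h with ⟨-, -, h1, h2⟩ | ⟨e, ⟨he, hs⟩ | ⟨he, hs⟩, hr⟩
  · linarith
  · exact ⟨e, κ, he, hs, hr, rfl, rfl, id, h5⟩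
  · refine ⟨e.reflect, κ.reflect, by simp [Config.reflect, he], hs, ?_, rfl, rfl, ?_, ?_⟩
    · exact Relation.ReflTransGen.lift Config.reflect (fun _ _ h => Go.reflect h) _ _ hr
    · intro h0
      rw [Config.reflect, point_neg, h0, neg_zero]
    · simp only [Config.reflect]
      linarith

/-! ### After the arrival at the opposite point -/

/-- `M` arises from `E` by moving and removing boxes within the interval from `lo` to `hi`, where
`m` boxes were removed. -/
def Touched (E M : Multiset ℝ) (m : ℕ) (lo hi : ℝ) : Prop :=
  ∃ Z R T : Multiset ℝ, E = Z + R ∧ M = R + T ∧ Z.card = m + T.card ∧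
    ∀ z ∈ Z + T, lo ≤ z ∧ z ≤ hi

namespace Touched

variable {E M : Multiset ℝ} {m : ℕ} {lo hi u : ℝ}

lemma mono (h : Touched E M m lo hi) {lo' hi' : ℝ} (hlo : lo' ≤ lo) (hhi : hi ≤ hi') :
    Touched E M m lo' hi' := by
  obtain ⟨Z, R, T, h1, h2, h3, h4⟩ := h
  exact ⟨Z, R, T, h1, h2, h3, fun z hz => ⟨hlo.trans (h4 z hz).1, (h4 z hz).2.trans hhi⟩⟩

lemma take (h : Touched E (u ::ₘ M) m lo hi) (hlo : lo ≤ u) (hhi : u ≤ hi) :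
    Touched E M (m + 1) lo hi := by
  obtain ⟨Z, R, T, h1, h2, h3, h4⟩ := h
  have hu : u ∈ R + T := by rw [← h2]; simp
  rcases Multiset.mem_add.mp hu with hu | hu
  · obtain ⟨R, rfl⟩ := Multiset.exists_cons_of_mem hu
    refine ⟨u ::ₘ Z, R, T, by rw [h1]; simp, ?_, by simp [h3]; omega, ?_⟩
    · rw [Multiset.cons_add] at h2
      exact (Multiset.cons_inj_right u).mp h2
    · intro z hz
      rw [Multiset.cons_add, Multiset.mem_cons] at hz
      rcases hz with rfl | hz
      · exact ⟨hlo, hhi⟩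
      · exact h4 z hz
  · obtain ⟨T, rfl⟩ := Multiset.exists_cons_of_mem hu
    refine ⟨Z, R, T, h1, ?_, by simp at h3; omega, ?_⟩
    · rw [Multiset.add_cons] at h2
      exact (Multiset.cons_inj_right u).mp h2
    · intro z hz
      refine h4 z ?_
      rw [Multiset.add_cons]
      exact Multiset.mem_cons_of_mem hz

lemma put (h : Touched E M (m + 1) lo hi) (hlo : lo ≤ u) (hhi : u ≤ hi) :
    Touched E (u ::ₘ M) m lo hi := by
  obtain ⟨Z, R, T, h1, h2, h3, h4⟩ := h
  refine ⟨Z, R, u ::ₘ T, h1, by rw [h2]; simp, by simp; omega, ?_⟩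
  intro z hz
  rw [Multiset.add_cons, Multiset.mem_cons] at hz
  rcases hz with rfl | hz
  · exact ⟨hlo, hhi⟩
  · exact h4 z hz

open Classical in
lemma le_card (h : Touched E M m lo hi) :
    m ≤ (E.filter fun z => lo ≤ z ∧ z ≤ hi).card := by
  obtain ⟨Z, R, T, h1, h2, h3, h4⟩ := h
  have : Z ≤ E.filter fun z => lo ≤ z ∧ z ≤ hi := by
    rw [Multiset.le_filter]
    exact ⟨by rw [h1]; simp, fun z hz => h4 z (by simp [hz])⟩
  have := Multiset.card_le_card this
  omega

end Touched

/-- A walk of length `len` on the line from `5 / 2` to `u` that covers the interval from `lo` to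
`hi` goes to one of its ends first. -/
def Covers (len lo hi u : ℝ) : Prop :=
  (5 / 2 - lo) + (hi - lo) + (hi - u) ≤ len ∨ (hi - 5 / 2) + (hi - lo) + (u - lo) ≤ len

open Classical in
/-- What is known about the walk from the arrival `e` at the opposite point on: `k` dawns have
passed, the length `len` was walked, and the interval from `lo K` to `hi K` was covered up to the
`K`-th dawn, or up to now if `K` dawns have not passed yet. As long as the base cannot have been
reached, the boxes in use come from those available at the arrival: `k` of them have been unsealed,
and by `card` at least `K` of them lie within what was covered up to the `K`-th dawn. The fields
`late` and `top` bound `len` from below by what is walked from the `K`-th dawn on. -/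
structure Onward (e κ : Config) (k : ℕ) (len : ℝ) (lo hi : ℕ → ℝ) : Prop where
  days : κ.N = e.N + k
  walked : len + e.w ≤ k + κ.w
  w_le : κ.w ≤ 1
  anti : Antitone lo
  mono : Monotone hi
  lo_eq : ∀ K, k < K → lo K = lo (k + 1)
  hi_eq : ∀ K, k < K → hi K = hi (k + 1)
  lo_le : lo (k + 1) ≤ κ.u
  le_hi : κ.u ≤ hi (k + 1)
  lo_zero : lo 0 ≤ 5 / 2
  hi_zero : 5 / 2 ≤ hi 0
  covers : Covers len (lo (k + 1)) (hi (k + 1)) κ.u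
  min_le : min e.lo (lo (k + 1)) ≤ κ.lo
  hi_le : κ.hi ≤ hi (k + 1)
  boxes : len < 5 / 2 → Touched (e.M.map ahead + load e.c (5 / 2)) (κ.M.map ahead)
    (k + (if κ.c then 1 else 0)) (lo (k + 1)) (hi (k + 1))
  cost : ∀ K : ℕ, 1 ≤ K → K ≤ k →
    (hi K - lo K) + min (5 / 2 - lo K) (hi K - 5 / 2) ≤ K - e.w
  late : ∀ K : ℕ, 1 ≤ K → K ≤ k → 5 / 2 - 2 * lo K + κ.u ≤ len
  top : ∀ K : ℕ, 1 ≤ K → K ≤ k →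
    hi (k + 1) = hi K ∨ 5 / 2 - 2 * lo K + 2 * hi (k + 1) - κ.u ≤ len
  card : ∀ K : ℕ, 1 ≤ K → K ≤ k → (K : ℝ) - e.w < 5 / 2 →
    K ≤ ((e.M.map ahead + load e.c (5 / 2)).filter fun z => lo K ≤ z ∧ z ≤ hi K).card

lemma Onward.start {e : Config} (he : e.u = 5 / 2) (hs : Splits e) :
    Onward e e 0 0 (fun _ => 5 / 2) (fun _ => 5 / 2) where
  days := by simp
  walked := by simp
  w_le := hs.2.2.1
  anti := antitone_const
  mono := monotone_const
  lo_eq _ _ := rfl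
  hi_eq _ _ := rfl
  lo_le := he.ge
  le_hi := he.le
  lo_zero := le_rfl
  hi_zero := le_rfl
  covers := by left; rw [he]; norm_num
  min_le := min_le_left _ _
  hi_le := hs.2.2.2.2.2.1
  boxes _ := by
    refine ⟨load e.c (5 / 2), e.M.map ahead, 0, add_comm _ _, by simp, ?_, ?_⟩
    · cases e.c <;> simp [load]
    · intro z hz
      cases h : e.c <;> simp [load, h] at hz
      simp [hz]
  cost K h1 h2 := by omega
  late K h1 h2 := by omega
  top K h1 h2 := by omega
  card K h1 h2 := by omega

namespace Onward

variable {e κ : Config} {k : ℕ} {len : ℝ} {lo hi : ℕ → ℝ}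

lemma dist_le (h : Onward e κ k len lo hi) : |κ.u - 5 / 2| ≤ len := by
  have h1 := h.lo_le
  have h2 := h.le_hi
  have h3 := (h.anti (Nat.zero_le (k + 1))).trans h.lo_zero
  have h4 := h.hi_zero.trans (h.mono (Nat.zero_le (k + 1)))
  rw [abs_le]
  rcases h.covers with h5 | h5 <;> constructor <;> linarith

lemma ahead_point (h : Onward e κ k len lo hi) (hl : len < 5 / 2) : ahead (point κ.u) = κ.u := by
  have := abs_le.mp h.dist_le
  exact MountainCircuit.ahead_point (by linarith) (by linarith)

lemma point_ne_zero (h : Onward e κ k len lo hi) (hl : len < 5 / 2) : point κ.u ≠ 0 := by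
  intro h0
  have h1 := abs_le.mp h.dist_le
  have := eq_zero_of_point h0 (by linarith) (by linarith)
  linarith

/-- A change of the boxes alone. -/
lemma change (h : Onward e κ k len lo hi) {c : Bool} {M : Multiset Circuit}
    (hb : len < 5 / 2 → Touched (e.M.map ahead + load e.c (5 / 2)) (M.map ahead)
      (k + (if c then 1 else 0)) (lo (k + 1)) (hi (k + 1))) :
    Onward e ⟨κ.N, κ.w, κ.u, c, M, κ.lo, κ.hi⟩ k len lo hi :=
  ⟨h.days, h.walked, h.w_le, h.anti, h.mono, h.lo_eq, h.hi_eq, h.lo_le, h.le_hi, h.lo_zero,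
    h.hi_zero, h.covers, h.min_le, h.hi_le, hb, h.cost, h.late, h.top, h.card⟩

lemma dawn (h : Onward e κ k len lo hi) {c : Bool} {M : Multiset Circuit}
    (hb : len < 5 / 2 → Touched (e.M.map ahead + load e.c (5 / 2)) (M.map ahead)
      (k + 1 + (if c then 1 else 0)) (lo (k + 1)) (hi (k + 1))) :
    Onward e ⟨κ.N + 1, 0, κ.u, c, M, κ.lo, κ.hi⟩ (k + 1) len lo hi := by
  have elo : lo (k + 2) = lo (k + 1) := h.lo_eq _ (by omega)
  have ehi : hi (k + 2) = hi (k + 1) := h.hi_eq _ (by omega)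
  have h1 := h.lo_le
  have h2 := h.le_hi
  have h3 := (h.anti (Nat.zero_le (k + 1))).trans h.lo_zero
  have h4 := h.hi_zero.trans (h.mono (Nat.zero_le (k + 1)))
  have h5 := h.walked
  have h6 := h.w_le
  refine ⟨by simp [h.days]; omega, by push_cast; linarith, zero_le_one, h.anti, h.mono, ?_, ?_,
    by rw [elo]; exact h.lo_le, by rw [ehi]; exact h.le_hi, h.lo_zero, h.hi_zero,
    by rw [elo, ehi]; exact h.covers, by rw [elo]; exact h.min_le, by rw [ehi]; exact h.hi_le,
    by rw [elo, ehi]; exact hb, ?_, ?_, ?_, ?_⟩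
  · intro K hK
    rw [elo]
    exact h.lo_eq K (by omega)
  · intro K hK
    rw [ehi]
    exact h.hi_eq K (by omega)
  · intro K hK1 hK
    rcases Nat.lt_or_eq_of_le hK with hK | rfl
    · exact h.cost K hK1 (by omega)
    · push_cast
      have m1 := min_le_left (5 / 2 - lo (k + 1)) (hi (k + 1) - 5 / 2)
      have m2 := min_le_right (5 / 2 - lo (k + 1)) (hi (k + 1) - 5 / 2)
      rcases h.covers with h7 | h7 <;> linarith
  · intro K hK1 hK
    rcases Nat.lt_or_eq_of_le hK with hK | rfl
    · exact h.late K hK1 (by omega)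
    · simp only
      rcases h.covers with h7 | h7 <;> linarith
  · intro K hK1 hK
    rcases Nat.lt_or_eq_of_le hK with hK | rfl
    · rw [ehi]
      exact h.top K hK1 (by omega)
    · exact .inl ehi
  · intro K hK1 hK hK2
    rcases Nat.lt_or_eq_of_le hK with hK | rfl
    · exact h.card K hK1 (by omega) hK2
    · push_cast at hK2
      have := (hb (by linarith)).le_card
      omega

lemma walk (h : Onward e κ k len lo hi) {d : ℝ} (hd : κ.w + |d| ≤ 1) :
    ∃ lo' hi', Onward e ⟨κ.N, κ.w + |d|, κ.u + d, κ.c, κ.M, min κ.lo (κ.u + d),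
      max κ.hi (κ.u + d)⟩ k (len + |d|) lo' hi' := by
  have h1 := h.lo_le
  have h2 := h.le_hi
  have h3 := (h.anti (Nat.zero_le (k + 1))).trans h.lo_zero
  have h4 := h.hi_zero.trans (h.mono (Nat.zero_le (k + 1)))
  have h5 := h.walked
  have d1 := le_abs_self d
  have d2 := neg_le_abs d
  have elo : (if k + 1 ≤ k then lo (k + 1) else min (lo (k + 1)) (κ.u + d)) =
    min (lo (k + 1)) (κ.u + d) := if_neg (by omega)
  have ehi : (if k + 1 ≤ k then hi (k + 1) else max (hi (k + 1)) (κ.u + d)) =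
    max (hi (k + 1)) (κ.u + d) := if_neg (by omega)
  refine ⟨fun K => if K ≤ k then lo K else min (lo (k + 1)) (κ.u + d),
    fun K => if K ≤ k then hi K else max (hi (k + 1)) (κ.u + d),
    h.days, by simp only; linarith, hd, ?_, ?_, ?_, ?_, ?_, ?_, ?_, ?_, ?_, ?_, ?_, ?_, ?_, ?_, ?_,
    ?_⟩
  · intro i j hij
    by_cases hj : j ≤ k
    · simp only [hj, hij.trans hj, if_true]
      exact h.anti hij
    · by_cases hi : i ≤ k
      · simp only [hi, hj, if_true, if_false]
        exact (min_le_left _ _).trans (h.anti (by omega))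
      · simp only [hi, hj, if_false, le_refl]
  · intro i j hij
    by_cases hj : j ≤ k
    · simp only [hj, hij.trans hj, if_true]
      exact h.mono hij
    · by_cases hi' : i ≤ k
      · simp only [hi', hj, if_true, if_false]
        exact (h.mono (by omega)).trans (le_max_left _ _)
      · simp only [hi', hj, if_false, le_refl]
  · intro K hK
    simp only [elo]
    exact if_neg (by omega)
  · intro K hK
    simp only [ehi]
    exact if_neg (by omega)
  · simp only [elo]
    exact min_le_right _ _
  · simp only [ehi]
    exact le_max_right _ _
  · simp only [Nat.zero_le, if_true]
    exact h.lo_zero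
  · simp only [Nat.zero_le, if_true]
    exact h.hi_zero
  · simp only [elo, ehi, Covers]
    rcases le_total (lo (k + 1)) (κ.u + d) with a1 | a1 <;>
    rcases le_or_gt (κ.u + d) (hi (k + 1)) with a2 | a2
    · rw [min_eq_left a1, max_eq_left a2]
      refine h.covers.imp (fun _ => ?_) (fun _ => ?_) <;> linarith
    · rw [min_eq_left a1, max_eq_right a2.le]
      left
      rcases h.covers with h6 | h6 <;> linarith
    · rw [min_eq_right a1, max_eq_left a2]
      right
      rcases h.covers with h6 | h6 <;> linarith
    · linarith
  · simp only [elo]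
    rw [← min_assoc]
    exact min_le_min_right _ h.min_le
  · simp only [ehi]
    exact max_le_max_right _ h.hi_le
  · intro hl
    simp only [elo, ehi]
    exact (h.boxes (by linarith [abs_nonneg d])).mono (min_le_left _ _) (le_max_left _ _)
  · intro K hK1 hK
    simp only [hK, if_true]
    exact h.cost K hK1 hK
  · intro K hK1 hK
    simp only [hK, if_true]
    linarith [h.late K hK1 hK]
  · intro K hK1 hK
    simp only [hK, if_true, ehi]
    have l := h.late K hK1 hK
    rcases le_total (κ.u + d) (hi (k + 1)) with a | a
    · rw [max_eq_left a]
      refine (h.top K hK1 hK).imp id fun _ => ?_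
      linarith
    · right
      rw [max_eq_right a]
      linarith
  · intro K hK1 hK hK2
    simp only [hK, if_true]
    exact h.card K hK1 hK hK2

end Onward

/-- Everything that happens after the arrival at the opposite point is recorded. -/
theorem exists_onward {e κ : Config} (he : e.u = 5 / 2) (hs : Splits e)
    (h : Relation.ReflTransGen Go e κ) : ∃ k len lo hi, Onward e κ k len lo hi := by
  induction h with
  | refl => exact ⟨_, _, _, _, Onward.start he hs⟩
  | tail _ hgo ih =>
    obtain ⟨k, len, lo, hi, ih⟩ := ih
    cases hgo with
    | walk d h =>
      obtain ⟨lo', hi', h'⟩ := ih.walk h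
      exact ⟨_, _, _, _, h'⟩
    | pick =>
      refine ⟨k, len, lo, hi, ih.change fun hl => ?_⟩
      have hb := ih.boxes hl
      rw [Multiset.map_cons, ih.ahead_point hl] at hb
      simpa using hb.take ih.lo_le ih.le_hi
    | pickBase h0 =>
      exact ⟨k, len, lo, hi, ih.change fun hl => absurd h0 (ih.point_ne_zero hl)⟩
    | dump =>
      refine ⟨k, len, lo, hi, ih.change fun hl => ?_⟩
      have hb := ih.boxes hl
      rw [Multiset.map_cons, ih.ahead_point hl]
      simpa using Touched.put (by simpa using hb) ih.lo_le ih.le_hi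
    | carried =>
      refine ⟨k + 1, len, lo, hi, ih.dawn fun hl => ?_⟩
      simpa using ih.boxes hl
    | lying =>
      refine ⟨k + 1, len, lo, hi, ih.dawn fun hl => ?_⟩
      have hb := ih.boxes hl
      rw [Multiset.map_cons, ih.ahead_point hl] at hb
      have := hb.take ih.lo_le ih.le_hi
      rwa [add_right_comm] at this
    | base h0 =>
      exact ⟨k + 1, len, lo, hi, ih.dawn fun hl => absurd h0 (ih.point_ne_zero hl)⟩

/-! ### What the two sides have cost at the arrival -/

/-- The distance from the base of a box at `v` in the near half, `0` for boxes in the far half. -/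
noncomputable def nearPart (v : ℝ) : ℝ := if v ≤ 5 / 2 then v else 0

/-- The distance from the base of a box at `v` in the far half, `0` for boxes in the near half. -/
noncomputable def farPart (v : ℝ) : ℝ := if v ≤ 5 / 2 then 0 else 5 - v

lemma parts_cases (v : ℝ) : (v ≤ 5 / 2 ∧ nearPart v = v ∧ farPart v = 0) ∨
    (5 / 2 < v ∧ nearPart v = 0 ∧ farPart v = 5 - v) := by
  unfold nearPart farPart
  rcases le_or_gt v (5 / 2) with h | h
  · exact .inl ⟨h, if_pos h, if_pos h⟩
  · exact .inr ⟨h, if_neg (not_le.mpr h), if_neg (not_le.mpr h)⟩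

lemma tot_map (W f : ℝ → ℝ) (M : Multiset ℝ) : tot W (M.map f) = tot (fun v => W (f v)) M := by
  simp [tot, Multiset.map_map]

/-- Lower bounds for the walks `An` and `Af` on the near and on the far side, before the last dawn
at which the opposite point had not been reached, in terms of the boxes `E` that are available
then; `t` has been walked since that dawn, and it came at a distance of at least `5 / 2 - t`. -/
structure Costs (E : Multiset ℝ) (t An Af : ℝ) : Prop where
  truncated : ∀ S ≤ E,
    vBoth (5 / 2 - t) + tot (fun v => wBoth (min (nearPart v) (5 / 2 - t))) S ≤ An
  carried : ∀ S ≤ E, vBoth (5 / 2 - t) + wBoth (5 / 2 - t) - wBoth (5 / 2) +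
    tot (fun v => wBoth (nearPart v)) S ≤ An
  sharp : ∀ v ∈ E, 5 / 2 - t ≤ nearPart v → 96 / 5 * (5 / 2 - t) - 102 / 5 ≤ An
  far : ∀ S ≤ E, tot (fun v => wBoth (farPart v)) S ≤ Af
  far_sharp : ∀ S ≤ E, ∀ v ∈ S, ∀ z, 0 < z → z ≤ farPart v →
    tot (fun v => 2 * farPart v) S + (60 * z - 50) / 7 ≤ Af
  far_deep : ∀ S ≤ E, ∀ v ∈ S, ∀ z, 1 ≤ z → z ≤ farPart v →
    tot (fun v => 2 * farPart v) S + (10 * z - 9) ≤ Af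
  near_nonneg : vBoth (5 / 2 - t) ≤ An
  far_nonneg : 0 ≤ Af

lemma wBoth_of_ge {x : ℝ} (h : 9 / 8 ≤ x) : wBoth x = 64 / 7 * x - 47 / 7 := by
  rcases both_cases x with ⟨_, e, _⟩ | ⟨_, _, e, _⟩ | ⟨_, _, e, _⟩ | ⟨_, _, e, _⟩ | ⟨_, e, _⟩ <;>
  rw [e] <;> linarith

theorem Splits.costs {e : Config} (h : Splits e) (hu : e.u = 5 / 2) :
    ∃ An Af, Costs (e.M.map ahead + load e.c (5 / 2)) e.w An Af ∧ An + Af ≤ e.N ∧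
      vBoth (-e.lo - 1 / 2) ≤ Af := by
  obtain ⟨p, Bn, An, a, Bf, Af, sn, sf, ha, hN, hlo⟩ := h.opposite hu
  have hw := h.2.2.1
  have hp := abs_le.mp sn.dist
  set E := e.M.map ahead + load e.c (5 / 2) with hE
  have en : e.M.map nearDist + load e.c (5 / 2) = E.map nearPart := by
    rw [hE, Multiset.map_add, Multiset.map_map]
    congr 1
    cases e.c <;> simp [load, nearPart]
  have ef : e.M.map farDist + load e.c 0 = E.map farPart := by
    rw [hE, Multiset.map_add, Multiset.map_map]
    congr 1
    cases e.c <;> simp [load, farPart]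
  have hn0 : ∀ v ∈ E, 0 ≤ nearPart v := fun v hv =>
    sn.load_nonneg _ (by rw [en]; exact Multiset.mem_map_of_mem _ hv)
  have hf0 : ∀ v ∈ E, 0 ≤ farPart v := fun v hv =>
    sf.load_nonneg _ (by rw [ef]; exact Multiset.mem_map_of_mem _ hv)
  have hV := sn.wBoth_le
  have hVp := vBoth_mono (show 5 / 2 - e.w ≤ p by linarith)
  have hfar : ∀ {W : ℝ → ℝ}, IsWeight W → ∀ S ≤ E,
      tot (fun v => W (farPart v)) S ≤ tot W (e.M.map farDist) := by
    intro W hW S hS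
    have h0 : tot W (load e.c 0) = 0 := by cases e.c <;> simp [hW.zero]
    have h1 : tot W (e.M.map farDist) = tot (fun v => W (farPart v)) E := by
      rw [← tot_map W farPart, ← ef, tot_add, h0, add_zero]
    rw [h1]
    exact tot_mono_of_le hS fun v hv => hW.nonneg (hf0 v hv)
  have hmem : ∀ v ∈ E, 0 < farPart v → farPart v ∈ e.M.map farDist := by
    intro v hv h0
    have := Multiset.mem_map_of_mem farPart hv
    rw [← ef, Multiset.mem_add] at this
    refine this.resolve_right fun h1 => ?_
    cases hc : e.c <;> simp [load, hc] at h1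
    linarith
  refine ⟨An, Af, ⟨?_, ?_, ?_, ?_, ?_, ?_, ?_, sf.walked_nonneg⟩, hN, hlo⟩
  · intro S hS
    have h1 := (sn.truncated isWeight_wBoth (θ := 5 / 2 - e.w) (by linarith)).resolve_right
      (by linarith)
    rw [en, tot_map] at h1
    have h2 := tot_mono_of_le (W := fun v => wBoth (min (nearPart v) (5 / 2 - e.w))) hS
      fun v hv => isWeight_wBoth.nonneg (le_min (hn0 v hv) (by linarith))
    linarith
  · intro S hS
    have h1 := sn.weight isWeight_wBoth
    rw [en, tot_map] at h1
    have h2 := tot_mono_of_le (W := fun v => wBoth (nearPart v)) hS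
      fun v hv => isWeight_wBoth.nonneg (hn0 v hv)
    rw [wBoth_of_ge (show 9 / 8 ≤ p by linarith),
      wBoth_of_ge (show 9 / 8 ≤ (a + p + 5 / 2) / 2 by linarith)] at h1
    rw [wBoth_of_ge (show (9 / 8 : ℝ) ≤ 5 / 2 - e.w by linarith),
      wBoth_of_ge (show (9 / 8 : ℝ) ≤ 5 / 2 by norm_num)]
    linarith
  · intro v hv hX
    exact sn.near_le (by linarith) (by linarith) (by linarith)
      (by rw [en]; exact Multiset.mem_map_of_mem _ hv) hX
  · intro S hS
    have h1 := sf.weight isWeight_wBoth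
    have h2 := sf.wBoth_le
    have h3 := hfar isWeight_wBoth S hS
    have h0 : tot wBoth (load e.c 0) = 0 := by cases e.c <;> simp [isWeight_wBoth.zero]
    rw [tot_add, h0, isWeight_wBoth.zero] at h1
    norm_num [isWeight_wBoth.zero, vBoth_zero] at h1 h2
    linarith
  · intro S hS v hv z hz hzv
    have h1 := sf.far_le hz (hmem v (Multiset.mem_of_le hS hv) (by linarith)) hzv
    have h2 := hfar isWeight_two_mul S hS
    linarith
  · intro S hS v hv z hz hzv
    have h1 := sf.deep_le hz (hmem v (Multiset.mem_of_le hS hv) (by linarith)) hzv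
    have h2 := hfar isWeight_two_mul S hS
    linarith
  · have h2 : 0 ≤ tot wBoth Bn :=
      tot_nonneg fun b hb => isWeight_wBoth.nonneg (sn.dawn_boxes_nonneg b hb)
    linarith

/-! ### Linear estimates for the costs -/

lemma vBoth_ge (x : ℝ) : 32 / 7 * x - 33 / 7 ≤ vBoth x ∧
    (9 / 8 ≤ x → 96 / 7 * x - 169 / 7 ≤ vBoth x) := by
  rcases both_cases x with ⟨_, _, e⟩ | ⟨_, _, _, e⟩ | ⟨_, _, _, e⟩ | ⟨_, _, _, e⟩ | ⟨_, _, e⟩ <;>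
  rw [e] <;> refine ⟨?_, fun _ => ?_⟩ <;> linarith

/-- The linear lower bounds for the value of a box that is at least at distance `m`. -/
lemma wBoth_ge_of_le {m x : ℝ} (h : m ≤ x) : 2 * m ≤ wBoth x ∧ 24 / 7 * m - 5 / 7 ≤ wBoth x ∧
    32 / 7 * m - 11 / 7 ≤ wBoth x ∧ 64 / 7 * m - 47 / 7 ≤ wBoth x := by
  have := wBoth_ge x
  refine ⟨?_, ?_, ?_, ?_⟩ <;> linarith

namespace Costs

variable {E : Multiset ℝ} {t An Af b₁ b₂ b₃ : ℝ}

/-- If one of two boxes is deep on the far side, more than twenty days have passed. -/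
lemma deep_pair (h : Costs E t An Af) (ht0 : 0 ≤ t) (ht1 : t ≤ 1) (hS : b₁ ::ₘ {b₂} ≤ E)
    (h1 : t + 3 / 2 ≤ farPart b₁) (h2 : t + 1 / 2 ≤ nearPart b₂ ∨ t + 1 / 2 ≤ farPart b₂) :
    20 < An + Af := by
  have hV := (vBoth_ge (5 / 2 - t)).2 (by linarith)
  rcases h2 with h2 | h2
  · have a1 := h.truncated {b₂} ((Multiset.le_cons_self _ _).trans hS)
    have a2 := h.far_deep {b₁} (Multiset.singleton_le.mpr (Multiset.mem_of_le hS (by simp))) b₁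
      (by simp) (t + 3 / 2) (by linarith) h1
    have a3 := (wBoth_ge_of_le (le_min h2 (show t + 1 / 2 ≤ 5 / 2 - t by linarith))).1
    simp [tot] at a1 a2
    linarith
  · have a1 := h.near_nonneg
    have a2 := h.far_deep _ hS b₁ (by simp) (t + 3 / 2) (by linarith) h1
    simp [tot] at a2
    linarith

/-- A box beyond the last dawn on the near side and two boxes on the far side: the case of the
optimal plan. Twenty full days precede the last dawn before the arrival, and more than twenty if
the arrival comes too early on the day after it for the optimal plan, where
`t = 83 / 116 = 1 / 2 + 25 / 116`. -/
lemma main_case (h : Costs E t An Af) (ht1 : t ≤ 1) (hn : b₁ ∈ E) (h1 : 5 / 2 - t ≤ nearPart b₁)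
    (hS : b₂ ::ₘ {b₃} ≤ E) (h2 : t + 1 / 2 ≤ farPart b₂) (h3 : t - 1 / 2 ≤ farPart b₃)
    (ht : 1 / 2 < t) : (t < 83 / 116 ∧ 20 < An + Af) ∨ (83 / 116 ≤ t ∧ 19 < An + Af) := by
  rcases lt_or_ge t (83 / 116) with h4 | h4
  · left
    have a1 := h.sharp b₁ hn h1
    have a2 := h.far_sharp _ hS b₂ (by simp) (t + 1 / 2) (by linarith) h2
    simp [tot] at a2
    exact ⟨h4, by linarith⟩
  · right
    have a1 := h.truncated {b₁} (Multiset.singleton_le.mpr hn)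
    have a2 := h.far_deep _ hS b₂ (by simp) (t + 1 / 2) (by linarith) h2
    have hV := (vBoth_ge (5 / 2 - t)).1
    have hW := wBoth_of_ge (show 9 / 8 ≤ 5 / 2 - t by linarith)
    simp [tot, min_eq_right h1] at a1 a2
    exact ⟨h4, by linarith⟩

/-- The analogue of `main_case` for an arrival in the first half of the day. -/
lemma main_case_early (h : Costs E t An Af) (ht0 : 0 ≤ t) (hn : b₁ ∈ E)
    (h1 : 5 / 2 - t ≤ nearPart b₁) (hb : b₂ ∈ E) (h2 : t + 1 / 2 ≤ farPart b₂) (ht : t ≤ 1 / 2) :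
    20 < An + Af := by
  have a1 := h.sharp b₁ hn h1
  have a2 := h.far_sharp {b₂} (Multiset.singleton_le.mpr hb) b₂ (by simp) (t + 1 / 2) (by linarith)
    h2
  simp [tot] at a2
  linarith

/-- A near box that is not beyond the last dawn, and a far box reached on the same walk. -/
lemma mixed_early (h : Costs E t An Af) (ht : t ≤ 1 / 2) (hn : b₁ ∈ E) (hb : b₂ ∈ E)
    (h1 : nearPart b₁ ≤ 5 / 2 - t)
    (h12 : (5 - farPart b₂ - nearPart b₁) + (5 / 2 - nearPart b₁) ≤ 2 - t) : 20 < An + Af := by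
  have a1 := h.truncated {b₁} (Multiset.singleton_le.mpr hn)
  have a2 := h.far {b₂} (Multiset.singleton_le.mpr hb)
  have hV := (vBoth_ge (5 / 2 - t)).2 (by linarith)
  simp [tot, min_eq_left h1] at a1 a2
  have w1 := (wBoth_ge (nearPart b₁)).2.2.2
  have w2 := (wBoth_ge (farPart b₂)).2.2.1
  linarith

/-- Two near boxes and one far box, the latter two reached on the same walk. -/
lemma mixed_late (h : Costs E t An Af) (ht : 1 / 2 < t) (ht1 : t ≤ 1) (hS : b₁ ::ₘ {b₂} ≤ E)
    (hb : b₃ ∈ E) (h1 : t + 3 / 2 ≤ nearPart b₁)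
    (hy : nearPart b₂ ≤ 5 / 2)
    (h23 : (5 - farPart b₃ - nearPart b₂) +
      min (5 / 2 - nearPart b₂) (5 / 2 - farPart b₃) ≤ 3 - t) :
    20 < An + Af := by
  set y := nearPart b₂
  set d := farPart b₃
  have a2 := h.far {b₃} (Multiset.singleton_le.mpr hb)
  have hV := (vBoth_ge (5 / 2 - t)).1
  have hX := wBoth_of_ge (show 9 / 8 ≤ 5 / 2 - t by linarith)
  have h5 := wBoth_of_ge (show (9 / 8 : ℝ) ≤ 5 / 2 by norm_num)
  have w1 := (wBoth_ge_of_le h1).2.2.2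
  have wd := wBoth_ge d
  have wy := wBoth_ge y
  have hd : 9 / 2 + t - 2 * y ≤ d ∨ 9 / 2 + t - y ≤ 2 * d := by
    rcases min_cases (5 / 2 - y) (5 / 2 - d) with ⟨e, _⟩ | ⟨e, _⟩ <;> rw [e] at h23
    · left; linarith
    · right; linarith
  rcases le_total (5 / 2 - t) y with hyX | hyX
  · have a1 := h.carried _ hS
    simp [tot] at a1 a2
    rcases hd with hd | hd <;> linarith [wd.2.1, wy.2.2.2]
  · have a1 := h.truncated _ hS
    simp [tot, min_eq_right (show 5 / 2 - t ≤ nearPart b₁ by linarith)] at a1 a2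
    change _ + (_ + wBoth (min y _)) ≤ _ at a1
    rw [min_eq_left hyX] at a1
    rcases hd with hd | hd
    · linarith [wd.2.2.1, wy.2.2.2]
    · linarith [wd.2.2.2, wy.2.2.1]

/-- If all boxes for the way on lie in the near half, at least eighteen days have passed; and more
than twenty if they are not too close to the base, or if the far side was explored for lack of
time to go on. Here `x` is the distance beyond the opposite point that is reached later; the
constants `25 / 232` and `79 / 58` express that less than `5 + 25 / 116 - t` may be walked after the
arrival. -/
lemma near_early (h : Costs E t An Af) (ht : t ≤ 1 / 2) (hS : b₁ ::ₘ {b₂} ≤ E)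
    (h1 : t + 3 / 2 ≤ nearPart b₁) (h2 : t + 1 / 2 ≤ nearPart b₂) :
    17 < An ∧
    ((5 / 2 - 25 / 232 - 5 / 4 + t / 2 : ℝ) ≤ nearPart b₂ → 20 < An) ∧
    (∀ x, 0 ≤ x → x ≤ 79 / 58 - t / 2 → t + 1 / 2 + x ≤ nearPart b₂ → 20 < An + vBoth (2 - x)) := by
  have a1 := h.truncated _ hS
  have hV := (vBoth_ge (5 / 2 - t)).2 (by linarith)
  have w1 := (wBoth_ge_of_le (le_min h1 (show t + 3 / 2 ≤ 5 / 2 - t by linarith))).2.2.2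
  simp [tot] at a1
  refine ⟨?_, fun h3 => ?_, fun x hx0 hx h3 => ?_⟩
  · have w2 := (wBoth_ge_of_le (le_min h2 (show t + 1 / 2 ≤ 5 / 2 - t by linarith))).2.2.1
    linarith
  · have w2 := (wBoth_ge_of_le (le_min h3
      (show (5 / 2 - 25 / 232 - 5 / 4 + t / 2 : ℝ) ≤ 5 / 2 - t by linarith))).2.2.2
    linarith
  · have hV2 := (vBoth_ge (2 - x)).1
    rcases le_total (t + 1 / 2 + x) (5 / 2 - t) with h4 | h4
    · have w2 := (wBoth_ge_of_le (le_min h3 h4)).2.2.1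
      linarith
    · have w2 := (wBoth_ge_of_le (le_min (h4.trans h3) le_rfl)).2.2.1
      linarith

/-- The analogue of `near_early` for an arrival in the second half of the day, when a third box is
needed on the way on. -/
lemma near_late (h : Costs E t An Af) (ht : 1 / 2 < t) (ht1 : t ≤ 1) (hS : b₁ ::ₘ b₂ ::ₘ {b₃} ≤ E)
    (h1 : t + 3 / 2 ≤ nearPart b₁) (h2 : t + 1 / 2 ≤ nearPart b₂) (h3 : t - 1 / 2 ≤ nearPart b₃) :
    17 < An ∧
    ((5 / 2 - 25 / 232 - 5 / 4 + t / 2 : ℝ) ≤ nearPart b₃ → 20 < An) ∧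
    (∀ x, 0 ≤ x → x ≤ 79 / 58 - t / 2 → t + 1 / 2 + x ≤ nearPart b₂ → t - 1 / 2 + x ≤ nearPart b₃ →
      20 < An + vBoth (2 - x)) := by
  have a1 := h.truncated _ hS
  have hV := (vBoth_ge (5 / 2 - t)).1
  have hX := wBoth_of_ge (show 9 / 8 ≤ 5 / 2 - t by linarith)
  have w2 := (wBoth_ge_of_le (le_min h2 (show t + 1 / 2 ≤ 5 / 2 - t by linarith))).2.2.2
  have w3 := (wBoth_ge_of_le (le_min h3 (show t - 1 / 2 ≤ 5 / 2 - t by linarith))).1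
  simp [tot, min_eq_right (show 5 / 2 - t ≤ nearPart b₁ by linarith)] at a1
  refine ⟨by linarith, fun h4 => ?_, fun x hx0 hx h4 h5 => ?_⟩
  · have w3' := (wBoth_ge_of_le (le_min (show (57 / 50 + t / 4 : ℝ) ≤ nearPart b₃ by linarith)
      (show (57 / 50 + t / 4 : ℝ) ≤ 5 / 2 - t by linarith))).2.2.2
    linarith
  · have hV2 := (vBoth_ge (2 - x)).1
    rcases le_total (t + 1 / 2 + x) (5 / 2 - t) with h6 | h6
    · have w2' := (wBoth_ge_of_le (le_min h4 h6)).2.2.2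
      linarith
    · have w2' := (wBoth_ge_of_le (le_min (h6.trans h4) le_rfl)).2.2.2
      have w3' := (wBoth_ge_of_le (le_min h5 (show t - 1 / 2 + x ≤ 5 / 2 - t by linarith))).2.2.1
      linarith

end Costs

/-! ### The lower bound -/

/-- The boxes reached up to the `K`-th dawn are not far from the opposite point. -/
lemma Onward.near_opposite {e κ : Config} {k : ℕ} {len : ℝ} {lo hi : ℕ → ℝ}
    (h : Onward e κ k len lo hi) {K : ℕ} (hK1 : 1 ≤ K) (hK : K ≤ k) {b : ℝ} (h1 : lo K ≤ b)
    (h2 : b ≤ hi K) : 5 / 2 - (K - e.w) ≤ b ∧ b ≤ 5 / 2 + (K - e.w) := by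
  have c := h.cost K hK1 hK
  have l := (h.anti (Nat.zero_le K)).trans h.lo_zero
  have r := h.hi_zero.trans (h.mono (Nat.zero_le K))
  rcases min_cases (5 / 2 - lo K) (hi K - 5 / 2) with ⟨m, _⟩ | ⟨m, _⟩ <;> rw [m] at c <;>
  constructor <;> linarith

/-- A near and a far box that are both reached up to the `K`-th dawn. -/
lemma Onward.pair {e κ : Config} {k : ℕ} {len : ℝ} {lo hi : ℕ → ℝ}
    (h : Onward e κ k len lo hi) {K : ℕ} (hK1 : 1 ≤ K) (hK : K ≤ k) {b b' : ℝ} (h1 : lo K ≤ b)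
    (hb : nearPart b = b) (h2 : b' ≤ hi K) (hb' : farPart b' = 5 - b') :
    (5 - farPart b' - nearPart b) + min (5 / 2 - nearPart b) (5 / 2 - farPart b') ≤ K - e.w := by
  have c := h.cost K hK1 hK
  have m : min (5 / 2 - b) (b' - 5 / 2) ≤ min (5 / 2 - lo K) (hi K - 5 / 2) :=
    min_le_min (by linarith) (by linarith)
  rw [hb, hb', show 5 / 2 - (5 - b') = b' - 5 / 2 by ring]
  linarith

lemma exists_cons_le {S F : Multiset ℝ} (h : S ≤ F) (hc : S.card < F.card) :
    ∃ b, b ::ₘ S ≤ F := by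
  apply Multiset.lt_iff_cons_le.mp
  refine lt_of_le_of_ne h fun he => ?_
  rw [he] at hc
  exact lt_irrefl _ hc

open Classical in
/-- The boxes that are unsealed after the arrival at the opposite point. -/
lemma Onward.exists_boxes {e κ : Config} {k : ℕ} {len : ℝ} {lo hi : ℕ → ℝ}
    (h : Onward e κ k len lo hi) (hw : 0 ≤ e.w) (hk : 2 ≤ k) :
    ∃ b₁ b₂, b₂ ::ₘ {b₁} ≤ e.M.map ahead + load e.c (5 / 2) ∧ (lo 1 ≤ b₁ ∧ b₁ ≤ hi 1) ∧
      (lo 2 ≤ b₂ ∧ b₂ ≤ hi 2) ∧ (1 / 2 < e.w → 3 ≤ k → ∃ b₃,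
        b₃ ::ₘ b₂ ::ₘ {b₁} ≤ e.M.map ahead + load e.c (5 / 2) ∧ (lo 3 ≤ b₃ ∧ b₃ ≤ hi 3)) := by
  set E := e.M.map ahead + load e.c (5 / 2)
  have c1 : 1 ≤ (E.filter fun z => lo 1 ≤ z ∧ z ≤ hi 1).card :=
    h.card 1 le_rfl (by omega) (by push_cast; linarith)
  have c2 : 2 ≤ (E.filter fun z => lo 2 ≤ z ∧ z ≤ hi 2).card :=
    h.card 2 (by norm_num) hk (by push_cast; linarith)
  obtain ⟨b₁, hb₁⟩ := exists_cons_le (Multiset.zero_le _)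
    (show (0 : Multiset ℝ).card < (E.filter fun z => lo 1 ≤ z ∧ z ≤ hi 1).card by
      rw [Multiset.card_zero]; omega)
  have m1 := (Multiset.mem_filter.mp (Multiset.mem_of_le hb₁ (Multiset.mem_cons_self _ _))).2
  have step : ∀ {S : Multiset ℝ} {i j : ℕ}, i ≤ j → S ≤ E.filter (fun z => lo i ≤ z ∧ z ≤ hi i) →
      S ≤ E.filter fun z => lo j ≤ z ∧ z ≤ hi j := by
    intro S i j hij hS
    rw [Multiset.le_filter] at hS ⊢
    exact ⟨hS.1, fun z hz => ⟨(h.anti hij).trans (hS.2 z hz).1, (hS.2 z hz).2.trans (h.mono hij)⟩⟩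
  obtain ⟨b₂, hb₂⟩ := exists_cons_le (step (show 1 ≤ 2 by norm_num) hb₁)
    (by rw [Multiset.card_cons, Multiset.card_zero]; omega)
  have m2 := (Multiset.mem_filter.mp (Multiset.mem_of_le hb₂ (Multiset.mem_cons_self _ _))).2
  refine ⟨b₁, b₂, hb₂.trans (Multiset.filter_le _ _), m1, m2, fun hw' hk' => ?_⟩
  have c3 : 3 ≤ (E.filter fun z => lo 3 ≤ z ∧ z ≤ hi 3).card :=
    h.card 3 (by norm_num) hk' (by push_cast; linarith)
  obtain ⟨b₃, hb₃⟩ := exists_cons_le (step (show 2 ≤ 3 by norm_num) hb₂)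
    (by rw [Multiset.card_cons, Multiset.card_cons, Multiset.card_zero]; omega)
  have m3 := (Multiset.mem_filter.mp (Multiset.mem_of_le hb₃ (Multiset.mem_cons_self _ _))).2
  exact ⟨b₃, hb₃.trans (Multiset.filter_le _ _), m3⟩

/-- The end of the expedition when all boxes used on the way on lie in the near half. Either the
base is reached on the far side, which is a long way from each of these boxes, or the professor
turns back at distance `x` beyond the opposite point, and the far side was explored before. -/
lemma Onward.ending {e κ : Config} {k : ℕ} {len : ℝ} {lo hi : ℕ → ℝ}
    (h : Onward e κ k len lo hi) (h0 : point κ.u = 0) (h5 : 5 ≤ κ.hi - κ.lo)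
    (hlen : len < 5 + 25 / 116 - e.w) (hw0 : 0 ≤ e.w) (hw1 : e.w ≤ 1) :
    (∀ K ≤ k, ∀ b, lo K ≤ b → 0 ≤ b → 5 / 2 - 25 / 232 - 5 / 4 + e.w / 2 ≤ b) ∨
    ∃ x, 0 ≤ x ∧ x ≤ 79 / 58 - e.w / 2 ∧ 2 - x ≤ -e.lo - 1 / 2 ∧
      ∀ K : ℕ, 2 ≤ K → K ≤ k → ∀ b, lo K ≤ b → e.w + (5 / 2 - K) + x ≤ b := by
  obtain ⟨n, hn⟩ := point_eq_zero_iff.mp h0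
  have a1 := h.lo_le
  have a2 := h.le_hi
  have a3 := (h.anti (Nat.zero_le (k + 1))).trans h.lo_zero
  have a4 := h.hi_zero.trans (h.mono (Nat.zero_le (k + 1)))
  have a5 := h.hi_le
  have a6 := h.min_le
  rcases le_or_gt 5 (hi (k + 1)) with hM | hM
  · left
    intro K hK b hb hb0
    have b1 := h.anti (show K ≤ k + 1 by omega)
    rcases h.covers with c | c <;> linarith
  · right
    have hn0 : n ≤ 0 := by
      have : (n : ℝ) < 1 := by linarith
      norm_cast at this
      omega
    have hn0' : (n : ℝ) ≤ 0 := by exact_mod_cast hn0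
    have hu : κ.u ≤ 0 := by linarith
    have h75 : κ.lo < lo (k + 1) := by
      by_contra hcon
      push Not at hcon
      rcases hn0.eq_or_lt with hn1 | hn1
      · have : κ.u = 0 := by rw [hn, hn1]; simp
        rcases h.covers with c | c <;> linarith
      · have : (n : ℝ) ≤ -1 := by exact_mod_cast (show n ≤ -1 by omega)
        rcases h.covers with c | c <;> linarith
    have a7 : e.lo ≤ κ.lo := by
      rcases min_le_iff.mp a6 with a6 | a6
      · exact a6
      · linarith
    refine ⟨hi (k + 1) - 5 / 2, by linarith, ?_, by linarith, ?_⟩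
    · rcases h.covers with c | c <;> linarith
    · intro K hK2 hK b hb
      have hK' : (2 : ℝ) ≤ K := by exact_mod_cast hK2
      rcases h.top K (by omega) hK with t | t
      · have c := h.cost K (by omega) hK
        have m : 0 ≤ min (5 / 2 - lo K) (hi K - 5 / 2) :=
          le_min (by linarith [(h.anti (Nat.zero_le K)).trans h.lo_zero]) (by linarith)
        linarith
      · linarith

/-- From the arrival at the opposite point on, the expedition takes too long if it is completed
in less than the time of the optimal plan. -/
theorem not_completed {e κ : Config} (he : e.u = 5 / 2) (hs : Splits e)
    (hr : Relation.ReflTransGen Go e κ) (h0 : point κ.u = 0) (h5 : 5 ≤ κ.hi - κ.lo) :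
    (23 + 25 / 116 : ℝ) ≤ κ.N + κ.w := by
  by_contra hlt
  push Not at hlt
  obtain ⟨k, len, lo, hi, h⟩ := exists_onward he hs hr
  obtain ⟨An, Af, hc, hN, hlo⟩ := hs.costs he
  set E := e.M.map ahead + load e.c (5 / 2) with hE
  set t := e.w with ht
  have ht0 : 0 ≤ t := by
    obtain ⟨_, _, _, _, _, _, _, _, _, _, _, _, _, _, sn, sf, h7, _⟩ := hs
    linarith [sn.nonneg, sf.nonneg]
  have ht1 : t ≤ 1 := hs.2.2.1
  have hdays : (κ.N : ℝ) = e.N + k := by exact_mod_cast h.days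
  have hwalk := h.walked
  have hw := h.w_le
  have hlen : 5 / 2 ≤ len := by
    obtain ⟨n, hn⟩ := point_eq_zero_iff.mp h0
    have hd := abs_le.mp h.dist_le
    rcases lt_or_ge 0 n with hn0 | hn0
    · have : (1 : ℝ) ≤ n := by exact_mod_cast hn0
      linarith
    · have : (n : ℝ) ≤ 0 := by exact_mod_cast hn0
      linarith
  have hk : 2 ≤ k := by
    have : (1 : ℝ) < k := by linarith
    exact_mod_cast this
  have hk3 : 1 / 2 < t → 3 ≤ k := by
    intro ht2
    have : (2 : ℝ) < k := by linarith
    exact_mod_cast this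
  -- More than twenty full days before the arrival leave no time for the way back.
  have h20 : An + Af ≤ 20 := by
    by_contra hcon
    have : (20 : ℝ) < e.N := by linarith
    have : (21 : ℝ) ≤ e.N := by exact_mod_cast this
    linarith
  have h19 : 83 / 116 ≤ t → An + Af ≤ 19 := by
    intro ht2
    by_contra hcon
    have : (19 : ℝ) < e.N := by linarith
    have : (20 : ℝ) ≤ e.N := by exact_mod_cast this
    linarith
  have h17 : 17 < An → len < 5 + 25 / 116 - t := by
    intro hA
    have : (17 : ℝ) < e.N := by linarith [hc.far_nonneg]
    have : (18 : ℝ) ≤ e.N := by exact_mod_cast this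
    linarith
  obtain ⟨b₁, b₂, hS, ⟨l1, r1⟩, ⟨l2, r2⟩, h3⟩ := h.exists_boxes ht0 hk
  have swap : ∀ a b : ℝ, a ::ₘ ({b} : Multiset ℝ) = b ::ₘ {a} := fun a b =>
    Multiset.cons_swap a b 0
  have hS' : b₁ ::ₘ {b₂} ≤ E := by rw [swap]; exact hS
  have m1 : b₁ ∈ E := Multiset.mem_of_le hS (by simp)
  have m2 : b₂ ∈ E := Multiset.mem_of_le hS (by simp)
  have d1 := h.near_opposite le_rfl (by omega) l1 r1
  have d2 := h.near_opposite (by norm_num) hk l2 r2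
  push_cast at d1 d2
  have f2 : t + 1 / 2 ≤ nearPart b₂ ∨ t + 1 / 2 ≤ farPart b₂ := by
    rcases parts_cases b₂ with ⟨_, e1, _⟩ | ⟨_, _, e2⟩
    · left; linarith
    · right; linarith
  rcases parts_cases b₁ with ⟨hb1, n1, -⟩ | ⟨hb1, -, n1⟩
  swap
  · linarith [hc.deep_pair ht0 ht1 hS' (by linarith) f2]
  have y1 : t + 3 / 2 ≤ nearPart b₁ := by linarith
  rcases le_or_gt t (1 / 2) with ht2 | ht2
  · rcases parts_cases b₂ with ⟨hb2, n2, -⟩ | ⟨hb2, z2, n2⟩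
    · have y2 : t + 1 / 2 ≤ nearPart b₂ := by linarith
      obtain ⟨A1, A2, A3⟩ := hc.near_early ht2 hS' y1 y2
      rcases h.ending h0 h5 (h17 A1) ht0 ht1 with hE1 | ⟨x, x0, x1, x2, x3⟩
      · have := A2 (by rw [n2]; exact hE1 2 hk b₂ l2 (by linarith))
        linarith [hc.far_nonneg]
      · have := A3 x x0 x1 (by
          have := x3 2 le_rfl hk b₂ l2
          push_cast at this
          linarith)
        linarith [vBoth_mono x2]
    · rcases le_or_gt (5 / 2 - t) (nearPart b₁) with hX | hX
      · linarith [hc.main_case_early ht0 m1 hX m2 (by linarith) ht2]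
      · have hp := h.pair (by norm_num) hk ((h.anti (show 1 ≤ 2 by norm_num)).trans l1) n1 r2 n2
        push_cast at hp
        rcases le_or_gt (t + 3 / 2) (farPart b₂) with hd | hd
        · linarith [hc.deep_pair ht0 ht1 hS hd (.inl (by linarith))]
        · rcases min_cases (5 / 2 - nearPart b₁) (5 / 2 - farPart b₂) with ⟨e1, _⟩ | ⟨e1, _⟩
          · rw [e1] at hp
            linarith [hc.mixed_early ht2 m1 m2 hX.le (by linarith)]
          · rw [e1] at hp
            linarith
  · have hX : 5 / 2 - t ≤ nearPart b₁ := by linarith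
    have hk3 := hk3 ht2
    obtain ⟨b₃, hS3, l3, r3⟩ := h3 ht2 hk3
    have m3 : b₃ ∈ E := Multiset.mem_of_le hS3 (by simp)
    have hS31 : b₃ ::ₘ {b₁} ≤ E := by
      refine le_trans (Multiset.cons_le_cons _ ?_) hS3
      exact Multiset.le_cons_self _ _
    have hS13 : b₁ ::ₘ {b₃} ≤ E := by rw [swap]; exact hS31
    have hS32 : b₃ ::ₘ {b₂} ≤ E := by
      refine le_trans (Multiset.cons_le_cons _ ?_) hS3
      exact Multiset.singleton_le.mpr (by simp)
    have hS23 : b₂ ::ₘ {b₃} ≤ E := by rw [swap]; exact hS32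
    have hS123 : b₁ ::ₘ b₂ ::ₘ {b₃} ≤ E := by
      have e1 : b₃ ::ₘ b₂ ::ₘ ({b₁} : Multiset ℝ) = b₁ ::ₘ b₂ ::ₘ {b₃} := by
        rw [Multiset.cons_swap b₃ b₂, swap b₃ b₁, Multiset.cons_swap b₂ b₁]
      rw [← e1]
      exact hS3
    have d3 := h.near_opposite (by norm_num) hk3 l3 r3
    push_cast at d3
    have l23 := (h.anti (show 2 ≤ 3 by norm_num)).trans l2
    have r23 := r2.trans (h.mono (show 2 ≤ 3 by norm_num))
    rcases parts_cases b₂ with ⟨hb2, n2, -⟩ | ⟨hb2, z2, n2⟩ <;>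
    rcases parts_cases b₃ with ⟨hb3, n3, -⟩ | ⟨hb3, z3, n3⟩
    · have y2 : t + 1 / 2 ≤ nearPart b₂ := by linarith
      have y3 : t - 1 / 2 ≤ nearPart b₃ := by linarith
      obtain ⟨A1, A2, A3⟩ := hc.near_late ht2 ht1 hS123 y1 y2 y3
      rcases h.ending h0 h5 (h17 A1) ht0 ht1 with hE1 | ⟨x, x0, x1, x2, x3⟩
      · have := A2 (by rw [n3]; exact hE1 3 hk3 b₃ l3 (by linarith))
        linarith [hc.far_nonneg]
      · have := A3 x x0 x1 (by
          have := x3 2 le_rfl hk b₂ l2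
          push_cast at this
          linarith) (by
          have := x3 3 (by norm_num) hk3 b₃ l3
          push_cast at this
          linarith)
        linarith [vBoth_mono x2]
    · have hp := h.pair (by norm_num) hk3 l23 n2 r3 n3
      push_cast at hp
      linarith [hc.mixed_late ht2 ht1 hS' m3 y1 (by linarith) hp]
    · have hp := h.pair (by norm_num) hk3 l3 n3 r23 n2
      push_cast at hp
      linarith [hc.mixed_late ht2 ht1 hS13 m2 y1 (by linarith) hp]
    · rcases hc.main_case ht1 m1 hX hS23 (by linarith) (by linarith) ht2 with ⟨_, g⟩ | ⟨g1, g⟩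
      · linarith
      · linarith [h19 g1]

/-- No plan that completes the circuit is faster than the optimal plan. -/
theorem duration_ge {plan : List (List Move)} (h : CompletesCircuit plan) :
    (23 + 25 / 116 : ℝ) ≤ duration plan := by
  obtain ⟨κ, hr, hd, h0, h5⟩ := lift_plan h
  obtain ⟨e, κ', he, hs, hr', hN, hw, h0', h5'⟩ := exists_opposite hr h5
  have := not_completed he hs hr' (h0' h0) h5'
  rw [hN, hw, hd] at this
  exact this

/-! ### Carrying out the optimal plan -/

/-- The point of the circuit reached from the base by walking `n / 116` miles. All places where
the optimal plan does something are of this form. -/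
noncomputable def mark (n : ℤ) : Circuit := ((n / 116 : ℝ) : Circuit)

/-- A move whose length is an integer number of 116ths of a mile. -/
inductive Leg where
  | walk (d : ℤ)
  | pickUp
  | dump

/-- The move with the given length. -/
noncomputable def Leg.move : Leg → Move
  | .walk d => .walk (d / 116)
  | .pickUp => .pickUp
  | .dump => .dump

/-- The length of a move, in 116ths of a mile. -/
def Leg.length : Leg → ℤ
  | .walk d => |d|
  | .pickUp => 0
  | .dump => 0

/-- A computable record of a state: `place` is the place unrolled to the line, `dumps` lists the
dumps by their representatives in `[0, 11600)`, both in 116ths of a mile, and everything from the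
base up to `far` has been seen. -/
structure Sketch where
  place : ℤ
  carrying : Bool
  dumps : List ℤ
  far : ℤ

namespace Sketch

/-- The sketch `k` is a record of the state `s`. -/
structure Shows (k : Sketch) (s : State) : Prop where
  place : s.place = mark k.place
  carrying : s.carrying = k.carrying
  dumps : s.dumps = (k.dumps.map mark : Multiset Circuit)
  seen : ∀ y : ℝ, 0 ≤ y → y ≤ k.far / 116 → (y : Circuit) ∈ s.seen

/-- The dumps that remain when a box is taken at the present place, if there is one. -/
def take (k : Sketch) : Option (List ℤ) :=
  if k.place % 11600 = 0 then some k.dumps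
  else if k.place % 11600 ∈ k.dumps then some (k.dumps.erase (k.place % 11600))
  else none

/-- The effect of a move, if it is possible. -/
def step (k : Sketch) : Leg → Option Sketch
  | .walk d => some ⟨k.place + d, k.carrying, k.dumps,
      if k.place ≤ k.far then max k.far (k.place + d) else k.far⟩
  | .pickUp =>
      if k.carrying then none else k.take.map fun D => ⟨k.place, true, D, k.far⟩
  | .dump =>
      if k.carrying then some ⟨k.place, false, k.place % 11600 :: k.dumps, k.far⟩ else none

/-- The effect of a list of moves. -/
def steps (k : Sketch) : List Leg → Option Sketch
  | [] => some k
  | m :: l => (k.step m).bind fun k' => k'.steps l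

/-- Unsealing a box at dawn, preferably the one that is carried. -/
def dawn (k : Sketch) : Option Sketch :=
  if k.carrying then some ⟨k.place, false, k.dumps, k.far⟩
  else k.take.map fun D => ⟨k.place, k.carrying, D, k.far⟩

/-- The effect of a plan, if it can be carried out. -/
def run (k : Sketch) : List (List Leg) → Option Sketch
  | [] => some k
  | day :: plan =>
      if (day.map Leg.length).sum ≤ 2320 then
        (k.dawn.bind fun k' => k'.steps day).bind fun k' => k'.run plan
      else none

end Sketch

lemma mark_emod (n : ℤ) : mark (n % 11600) = mark n := by
  have h : (n : ℝ) = (n % 11600 : ℤ) + 11600 * (n / 11600 : ℤ) := by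
    exact_mod_cast (Int.emod_add_mul_ediv n 11600).symm
  rw [mark, mark, h, show (((n % 11600 : ℤ) : ℝ) + 11600 * (n / 11600 : ℤ)) / 116 =
    (n % 11600 : ℤ) / 116 + (n / 11600 : ℤ) • (100 : ℝ) by rw [zsmul_eq_mul]; ring,
    AddCircle.coe_add, AddCircle.coe_zsmul, AddCircle.coe_period, smul_zero, add_zero]

lemma mark_add (n d : ℤ) : mark (n + d) = mark n + ((d / 116 : ℝ) : Circuit) := by
  simp [mark, add_div]

lemma mark_of_emod_eq_zero {n : ℤ} (h : n % 11600 = 0) : mark n = 0 := by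
  rw [← mark_emod, h]; simp [mark]

namespace Sketch

variable {k k' : Sketch} {s : State}

lemma Shows.take (hk : k.Shows s) {D : List ℤ} (h : k.take = some D) :
    Take s (D.map mark : Multiset Circuit) := by
  obtain ⟨p, c, M, S⟩ := s
  obtain ⟨hp, hc, hM, -⟩ := hk
  simp only at hp hc hM
  unfold Sketch.take at h
  split_ifs at h with h0 h1
  · obtain rfl := Option.some.inj h
    rw [mark_of_emod_eq_zero h0] at hp
    subst hp hM
    exact .base _ _ _
  · obtain rfl := Option.some.inj h
    have hM' : M = p ::ₘ ((k.dumps.erase (k.place % 11600)).map mark : Multiset Circuit) := by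
      rw [hM, hp, ← mark_emod k.place, Multiset.cons_coe, ← List.map_cons, Multiset.coe_eq_coe]
      exact (List.perm_cons_erase h1).map mark
    rw [hM']
    exact .dumped _ _ _ _

lemma Shows.step (hk : k.Shows s) {m : Leg} (h : k.step m = some k') :
    ∃ t, Step s m.move t ∧ k'.Shows t := by
  cases m with
  | walk d =>
    obtain rfl := Option.some.inj h
    refine ⟨_, .walk s _, by simp [hk.place, mark_add], hk.carrying, hk.dumps, fun y h0 hy => ?_⟩
    by_cases hfar : y ≤ k.far / 116
    · exact .inl (hk.seen y h0 hfar)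
    · -- Beyond `far` the point lies on the stretch walked now, which starts before `far`.
      right
      simp only at hy
      split_ifs at hy with hle
      · push Not at hfar
        have hle' : (k.place : ℝ) ≤ k.far := by exact_mod_cast hle
        push_cast at hy
        have hy' : y ≤ ((k.place : ℝ) + d) / 116 := by
          rcases max_choice (k.far : ℝ) (k.place + d) with e | e <;> rw [e] at hy <;> linarith
        refine ⟨y - k.place / 116, Set.mem_uIcc_of_le (by linarith) (by linarith), ?_⟩
        simp only [hk.place, mark, ← AddCircle.coe_add]
        congr 1; ring
      · exact absurd hy hfar
  | pickUp =>
    simp only [Sketch.step] at h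
    split_ifs at h with hc
    obtain ⟨D, hD, rfl⟩ := Option.map_eq_some_iff.1 h
    exact ⟨_, .pickUp s _ (by simpa [hk.carrying] using hc) (hk.take hD),
      hk.place, rfl, rfl, hk.seen⟩
  | dump =>
    simp only [Sketch.step] at h
    split_ifs at h with hc
    obtain rfl := Option.some.inj h
    exact ⟨_, .dump s (hk.carrying.trans hc), hk.place, rfl,
      by simp [hk.dumps, hk.place, mark_emod], hk.seen⟩

lemma Shows.steps {l : List Leg} : ∀ {k : Sketch} {s : State}, k.Shows s → k.steps l = some k' →
    ∃ t, Steps s (l.map Leg.move) t ∧ k'.Shows t := by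
  induction l with
  | nil =>
    intro k s hk h
    obtain rfl := Option.some.inj h
    exact ⟨s, .nil s, hk⟩
  | cons m l ih =>
    intro k s hk h
    obtain ⟨k₁, h₁, h₂⟩ := Option.bind_eq_some_iff.1 h
    obtain ⟨t, ht, hk₁⟩ := hk.step h₁
    obtain ⟨u, hu, hk'⟩ := ih hk₁ h₂
    exact ⟨u, .cons ht hu, hk'⟩

lemma Shows.dawn (hk : k.Shows s) (h : k.dawn = some k') : ∃ t, Unseal s t ∧ k'.Shows t := by
  unfold Sketch.dawn at h
  split_ifs at h with hc
  · obtain rfl := Option.some.inj h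
    exact ⟨_, .carried s (hk.carrying.trans hc), hk.place, rfl, hk.dumps, hk.seen⟩
  · obtain ⟨D, hD, rfl⟩ := Option.map_eq_some_iff.1 h
    exact ⟨_, .lying s _ (hk.take hD), hk.place, hk.carrying, rfl, hk.seen⟩

lemma miles_move (l : List Leg) :
    miles (l.map Leg.move) = ((l.map Leg.length).sum : ℤ) / 116 := by
  induction l with
  | nil => simp [miles]
  | cons m l ih =>
    simp only [miles, List.map_cons, List.sum_cons] at ih ⊢
    rw [ih]
    cases m <;> simp [Leg.move, Leg.length, Move.miles, abs_div, add_div]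

lemma Shows.run {plan : List (List Leg)} : ∀ {k : Sketch} {s : State}, k.Shows s →
    k.run plan = some k' → ∃ t, Run s (plan.map (List.map Leg.move)) t ∧ k'.Shows t := by
  induction plan with
  | nil =>
    intro k s hk h
    obtain rfl := Option.some.inj h
    exact ⟨s, .nil s, hk⟩
  | cons day plan ih =>
    intro k s hk h
    simp only [Sketch.run] at h
    split_ifs at h with hm
    obtain ⟨k₂, h₂, h₃⟩ := Option.bind_eq_some_iff.1 h
    obtain ⟨k₁, h₁, h₂⟩ := Option.bind_eq_some_iff.1 h₂
    obtain ⟨t₁, ht₁, hk₁⟩ := hk.dawn h₁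
    obtain ⟨t₂, ht₂, hk₂⟩ := hk₁.steps h₂
    obtain ⟨u, hu, hk'⟩ := ih hk₂ h₃
    refine ⟨u, .cons ⟨t₁, ht₁, ht₂, ?_⟩ hu, hk'⟩
    have hm' : (((day.map Leg.length).sum : ℤ) : ℝ) ≤ 2320 := by exact_mod_cast hm
    rw [miles_move]
    linarith

end Sketch

open Leg in
/-- The moves of `dawnPlan`, in 116ths of a mile. -/
def dawnLegs : List (List Leg) :=
  [ [pickUp, walk 1000, dump, walk (-1000),
      pickUp, walk (-80), dump, walk 80,
      pickUp, walk (-80), dump, walk 80],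
    [pickUp, walk (-360), dump, walk 280, pickUp, walk (-400), dump,
      walk 400, pickUp, walk (-400), dump, walk 480],
    [pickUp, walk (-1160), dump, walk 1160],
    [pickUp, walk (-1280), dump, walk 120, pickUp, walk (-120), dump,
      walk 800],
    [pickUp, walk (-1560), dump, walk 760],
    [pickUp, walk (-1540), dump, walk 780],
    [walk 1680, pickUp, walk (-140), dump, walk 500],
    [pickUp, walk 1080, dump, walk (-80), pickUp, walk 80, dump,
      walk (-1080)],
    [pickUp, walk 1160, dump, walk (-1160)],
    [pickUp, walk 1160, dump, walk (-1160)],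
    [pickUp, walk 1160, dump, walk (-1160)],
    [pickUp, walk 1160, dump, walk (-1160)],
    [pickUp, walk 1160, dump, walk (-1160)],
    [pickUp, walk 1430, dump, walk (-270), pickUp, walk 270, dump,
      walk (-350)],
    [pickUp, walk 1200, dump, walk (-1120)],
    [pickUp, walk 1140, dump, walk (-20), pickUp, walk 20, dump,
      walk (-1140)],
    [pickUp, walk 1295, dump, walk (-1025)],
    [pickUp, walk 1310, dump, walk (-285), pickUp, walk 285, dump,
      walk (-440)],
    [pickUp, walk 1380, dump, walk (-940)],
    [pickUp, walk 1400, dump, walk (-460), pickUp, walk 460],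
    [pickUp, walk 2320],
    [walk 2320],
    [walk 2320],
    [walk 500] ]

lemma dawnPlan_eq : dawnPlan = dawnLegs.map (List.map Leg.move) := by
  norm_num [dawnPlan, dawnLegs, Leg.move]

set_option maxRecDepth 20000 in
lemma dawnLegs_run :
    (Sketch.mk 0 false [] 0).run dawnLegs = some ⟨11600, false, [], 11600⟩ := by
  rfl

theorem completesCircuit_dawnPlan : CompletesCircuit dawnPlan := by
  have hstart : (Sketch.mk 0 false [] 0).Shows start :=
    ⟨by simp [start, mark], rfl, rfl, fun y h0 hy => by
      obtain rfl : y = 0 := le_antisymm (by simpa using hy) h0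
      simp [start]⟩
  obtain ⟨t, ht, hk⟩ := hstart.run dawnLegs_run
  refine ⟨t, dawnPlan_eq ▸ ht, hk.place.trans (mark_of_emod_eq_zero (by norm_num)), ?_⟩
  refine Set.eq_univ_of_forall fun p => ?_
  have : Fact ((0 : ℝ) < 100) := ⟨by norm_num⟩
  obtain ⟨y, hy, rfl⟩ := (AddCircle.coe_image_Ico_eq (100 : ℝ) 0).ge (Set.mem_univ p)
  exact hk.seen y hy.1 (by norm_num; linarith [hy.2])

theorem duration_dawnPlan : duration dawnPlan = 23 + 25 / 116 := by
  norm_num [duration, dawnPlan, miles, Move.miles]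

end MountainCircuit

theorem mainTheorem2 :
    (MountainCircuit.CompletesCircuit MountainCircuit.dawnPlan ∧
      MountainCircuit.duration MountainCircuit.dawnPlan = 23 + 25 / 116) ∧
    IsLeast {T : ℝ | ∃ plan : List (List MountainCircuit.Move),
        MountainCircuit.CompletesCircuit plan ∧ MountainCircuit.duration plan = T}
      (23 + 25 / 116) := by
  have hplan := MountainCircuit.completesCircuit_dawnPlan
  have hdur := MountainCircuit.duration_dawnPlan
  refine ⟨⟨hplan, hdur⟩, ⟨MountainCircuit.dawnPlan, hplan, hdur⟩, ?_⟩
  rintro _ ⟨plan, h, rfl⟩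
  exact MountainCircuit.duration_ge h
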